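/- For a prime power $q$, a code is a linear subspace $C\le\mathbb F_q^n$. Let $C^\perp$ be its orthogonal with respect to the dot product; $C$ is self-orthogonal if $C\subseteq C^\perp$. The Witt index $w(q,n)$ is the largest dimension of a self-orthogonal code in $\mathbb F_q^n$. The minimum distance $d(C)$ of a nonzero code $C$ is the minimum Hamming weight (number of nonzero coordinates) of a nonzero vector of $C$. Let $\Sigma_q(n,k)$ be the set of $k$-dimensional self-orthogonal codes in $\mathbb F_q^n$. Let $4\le d<n$ and $k=n-d+1$, and for prime powers $q$ with $k\le w(q,n)$ put $$P(q)=\frac{|\{C\in\Sigma_q(n,k)\mid d(C)\le d-1\}|}{|\Sigma_q(n,k)|},$$ which is the proportion of non-MDS codes in $\Sigma_q(n,k)$. All limits below are for $q\to\infty$, where $q$ runs through the prime powers with $k\le w(q,n)$. (a) If $k<n/2$, then $P(q)\sim\binom nk q^{-1}$, that is, $$\lim_{q\to\infty}\frac{P(q)}{\binom nk q^{-1}}=1 .$$ (b) If $k=n/2$, then $P(q)$ is asymptotically at least $\binom n{d-2}q^{-2}$ and asymptotically at most $\binom n{d-1}q^{-1}$, that is, $$\binom n{d-2}\le\liminf_{q\to\infty}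 q^2P(q)\qquad\text{and}\qquad \limsup_{q\to\infty} q\,P(q)\le\binom n{d-1}.$$ -/

import Mathlib

open Filter Topology

namespace SelfOrthCode

noncomputable section

/-- A prime power `q`. -/
abbrev PrimePower : Type := {q : ℕ // IsPrimePow q}

instance (q : PrimePower) : Fact q.1.minFac.Prime :=
  ⟨Nat.minFac_prime q.2.ne_one⟩

/-- The finite field with `q` elements: if `q = p ^ m`, then `p = q.minFac`, and `m` is
the exponent of `p` in the factorization of `q`. -/
abbrev Fq (q : PrimePower) : Type :=
  GaloisField q.1.minFac (q.1.factorization q.1.minFac)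

theorem card_Fq (q : PrimePower) : Nat.card (Fq q) = q.1 := by
  have h := q.2.minFac_pow_factorization_eq
  rw [GaloisField.card]
  · exact h
  · intro h0
    rw [h0, pow_zero] at h
    exact q.2.ne_one h.symm

section Codes

variable {F : Type} [Field F] {n : ℕ}

/-- The orthogonal `C^⊥` of a code `C ≤ F ^ n` with respect to the dot product. -/
def dualCode (C : Submodule F (Fin n → F)) : Submodule F (Fin n → F) :=
  LinearMap.BilinForm.orthogonal (dotProductBilin F F) C

/-- A code is self-orthogonal if `C ≤ C^⊥`. -/
def IsSelfOrthogonal (C : Submodule F (Fin n → F)) : Prop :=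
  C ≤ dualCode C

open Classical in
/-- The minimum Hamming distance of a (nonzero) code, that is, the minimum Hamming weight of
its nonzero elements. -/
def minDist (C : Submodule F (Fin n → F)) : ℕ :=
  sInf {t : ℕ | ∃ v ∈ C, v ≠ 0 ∧ hammingNorm v = t}

variable (F n)

/-- The Witt index of `F ^ n` with the dot product: the maximum dimension of a self-orthogonal
code in `F ^ n`. -/
def wittIndex : ℕ :=
  sSup {m : ℕ | ∃ C : Submodule F (Fin n → F), IsSelfOrthogonal C ∧ Module.finrank F C = m}

/-- The set of all self-orthogonal codes of dimension `k` in `F ^ n`. -/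
def selfOrthCodes (k : ℕ) : Set (Submodule F (Fin n → F)) :=
  {C | Module.finrank F C = k ∧ IsSelfOrthogonal C}

/-- The proportion of the codes with minimum distance at most `d - 1` among the
`k`-dimensional self-orthogonal codes in `F ^ n`. -/
def proportion (k d : ℕ) : ℝ :=
  ({C ∈ selfOrthCodes F n k | minDist C ≤ d - 1}.ncard : ℝ) / ((selfOrthCodes F n k).ncard : ℝ)

end Codes

/-- The filter of `q → ∞`, where `q` runs through the prime powers for which `k` is at most the
Witt index of `(𝔽_q) ^ n`. -/
def qToInfty (n k : ℕ) : Filter PrimePower :=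
  comap (fun q : PrimePower => q.1) atTop ⊓ 𝓟 {q | k ≤ wittIndex (Fq q) n}

end

end SelfOrthCode

/-! Call `v` singular if `v ⬝ᵥ v = 0`. A self-orthogonal code has minimum distance at most `d - 1`
iff it contains a nonzero singular vector of weight at most `d - 1`. The proportion of such codes is
estimated by first and second moments.

Two counts feed the moments. A set of `s` coordinates supports about `q ^ (s - 1)` singular vectors,
so about `choose n s * q ^ (s - 1)` of them have weight at most `s`. A given singular vector lies in
a fraction of about `q ^ (k - n + 1)` of the codes, and an independent pair in at most about `q ^ (2
* k - 2 * n + 3)`. The second count comes from building codes one vector at a time: if every space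
of dimension `i` in a family has about `A i` admissible extensions, the number of `k`-dimensional
members above a space depends, up to a factor tending to 1, only on its dimension (`extCount_le`,
`le_extCount`, `extCount_regular`).

The first moment with `s = d - 1`, divided by the `q - 1` multiples of each vector, gives `choose n
(d - 1) / q` as an upper bound (`RegularCodes.mul_div_le`). The second moment shows that few codes
contain independent low-weight vectors (`RegularCodes.le_pow_mul_div`). If `2 * k < n`, any two
supports of size `d - 1` meet, so orthogonality costs a pair another factor `q` and the bounds
agree. If `2 * k = n`, supports of size `d - 1` can be disjoint and the pairs are no longer
negligible; the lower bound then uses only weight `d - 2`, losing a factor `q`.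

Characteristic 2 is special because `x ⬝ᵥ x = (1 ⬝ᵥ x) ^ 2`: the number of extensions of `U` depends
on whether `1 ∈ U`. For `2 * k < n` the codes with totally singular orthogonal are split off and
shown to be rare (`ncard_not_nonsingularPerp_le`); for `2 * k = n` every code contains `1`, and the
building starts from its span. In odd characteristic with `2 * k = n` the last step has twice the
usual number of extensions. When `n = 6` singular vectors of weight 2 are needed; they exist because
a self-dual code of odd dimension makes `-1` a square. -/

namespace SelfOrthCode

noncomputable section

/-! ### Orthogonal complements and totally singular subspaces -/

section Orthogonal

variable {F ι : Type*} [Field F] [Fintype ι]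

/-- The orthogonal of a subspace of `F ^ ι` with respect to the dot product. -/
def perp (U : Submodule F (ι → F)) : Submodule F (ι → F) :=
  LinearMap.BilinForm.orthogonal (dotProductBilin F F) U

theorem mem_perp {U : Submodule F (ι → F)} {x : ι → F} :
    x ∈ perp U ↔ ∀ u ∈ U, u ⬝ᵥ x = 0 := Iff.rfl

theorem nondegenerate_dotProduct :
    LinearMap.BilinForm.Nondegenerate
      (dotProductBilin F F : LinearMap.BilinForm F (ι → F)) := by
  constructor
  · intro x hx
    exact dotProduct_eq_zero x hx
  · intro x hx
    exact dotProduct_eq_zero x fun w => by rw [dotProduct_comm]; exact hx w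

theorem isRefl_dotProduct :
    LinearMap.BilinForm.IsRefl (dotProductBilin F F : LinearMap.BilinForm F (ι → F)) := by
  intro x y h
  change y ⬝ᵥ x = 0
  rw [dotProduct_comm]
  exact h

theorem finrank_perp_add (U : Submodule F (ι → F)) :
    Module.finrank F (perp U) + Module.finrank F U = Fintype.card ι := by
  have h := LinearMap.BilinForm.finrank_orthogonal
    (nondegenerate_dotProduct (F := F) (ι := ι)) U
  have h2 := Submodule.finrank_le U
  rw [Module.finrank_fintype_fun_eq_card] at h h2
  unfold perp
  omega

theorem perp_perp (U : Submodule F (ι → F)) : perp (perp U) = U :=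
  LinearMap.BilinForm.orthogonal_orthogonal nondegenerate_dotProduct isRefl_dotProduct U

theorem perp_anti {U W : Submodule F (ι → F)} (h : U ≤ W) : perp W ≤ perp U :=
  fun _ hx u hu => hx u (h hu)

theorem le_perp_comm {U W : Submodule F (ι → F)} : U ≤ perp W ↔ W ≤ perp U := by
  constructor <;> intro h x hx <;> refine mem_perp.2 fun u hu => ?_ <;>
    rw [dotProduct_comm] <;> exact h hu x hx

theorem mem_perp_span_singleton {v x : ι → F} :
    x ∈ perp (Submodule.span F {v}) ↔ v ⬝ᵥ x = 0 := by
  constructor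
  · intro h
    exact h v (Submodule.mem_span_singleton_self v)
  · refine fun h => mem_perp.2 fun u hu => ?_
    obtain ⟨a, rfl⟩ := Submodule.mem_span_singleton.1 hu
    rw [smul_dotProduct, h, smul_zero]

theorem perp_sup (U W : Submodule F (ι → F)) : perp (U ⊔ W) = perp U ⊓ perp W := by
  apply le_antisymm (le_inf (perp_anti le_sup_left) (perp_anti le_sup_right))
  rw [← le_perp_comm, sup_le_iff, le_perp_comm, le_perp_comm (U := W)]
  exact ⟨inf_le_left, inf_le_right⟩

theorem mem_perp_sup_span {U : Submodule F (ι → F)} {v x : ι → F} :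
    x ∈ perp (U ⊔ Submodule.span F {v}) ↔ x ∈ perp U ∧ v ⬝ᵥ x = 0 := by
  rw [perp_sup, Submodule.mem_inf, mem_perp_span_singleton]

theorem perp_bot : perp (⊥ : Submodule F (ι → F)) = ⊤ := by
  rw [eq_top_iff]
  refine fun x _ => mem_perp.2 fun u hu => ?_
  rw [(Submodule.mem_bot F).1 hu, zero_dotProduct]

/-- Self-orthogonality of subspaces of `F ^ ι` for an arbitrary finite index type. -/
def SelfPerp (U : Submodule F (ι → F)) : Prop := U ≤ perp U

theorem selfPerp_bot : SelfPerp (⊥ : Submodule F (ι → F)) := bot_le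

theorem SelfPerp.mono {U W : Submodule F (ι → F)} (h : SelfPerp W) (hUW : U ≤ W) :
    SelfPerp U := hUW.trans (le_trans h (perp_anti hUW))

theorem SelfPerp.dotProduct_self {U : Submodule F (ι → F)} (h : SelfPerp U) {v : ι → F}
    (hv : v ∈ U) : v ⬝ᵥ v = 0 := h hv v hv

theorem SelfPerp.two_mul_finrank_le {U : Submodule F (ι → F)} (h : SelfPerp U) :
    2 * Module.finrank F U ≤ Fintype.card ι := by
  have h1 := finrank_perp_add U
  have h2 := Submodule.finrank_mono h
  omega

theorem selfPerp_sup_span {U : Submodule F (ι → F)} (hU : SelfPerp U) {v : ι → F} :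
    SelfPerp (U ⊔ Submodule.span F {v}) ↔ v ∈ perp U ∧ v ⬝ᵥ v = 0 := by
  constructor
  · intro h
    exact mem_perp_sup_span.1 (h (Submodule.mem_sup_right (Submodule.mem_span_singleton_self v)))
  · intro h
    apply sup_le
    · intro u hu
      refine mem_perp_sup_span.2 ⟨hU hu, ?_⟩
      rw [dotProduct_comm]
      exact h.1 u hu
    · rw [Submodule.span_singleton_le_iff_mem]
      exact mem_perp_sup_span.2 h

theorem finrank_sup_span {V : Type*} [AddCommGroup V] [Module F V] [FiniteDimensional F V]
    {U : Submodule F V} {v : V} (hv : v ∉ U) :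
    Module.finrank F ↥(U ⊔ Submodule.span F {v}) = Module.finrank F U + 1 := by
  have h := Submodule.finrank_sup_add_finrank_inf_eq U (Submodule.span F {v})
  have hv0 : v ≠ 0 := fun h0 => hv (h0 ▸ U.zero_mem)
  rw [finrank_span_singleton hv0] at h
  have hd : U ⊓ Submodule.span F {v} = ⊥ := by
    rw [← disjoint_iff, Submodule.disjoint_span_singleton' hv0]
    exact hv
  rw [hd, finrank_bot] at h
  omega

/-- In odd characteristic a totally singular subspace is self-orthogonal. -/
theorem selfPerp_of_dotProduct_self (h2 : (2 : F) ≠ 0) {W : Submodule F (ι → F)}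
    (h : ∀ x ∈ W, x ⬝ᵥ x = 0) : SelfPerp W := by
  intro x hx y hy
  have h1 := h (x + y) (W.add_mem hx hy)
  rw [dotProduct_add, add_dotProduct, add_dotProduct, h x hx, h y hy, dotProduct_comm x y] at h1
  have h3 : 2 * (y ⬝ᵥ x) = 0 := by linear_combination h1
  exact (mul_eq_zero.1 h3).resolve_left h2

/-- In characteristic two the dot square is the square of a linear form. -/
theorem dotProduct_self_of_two_eq_zero (h2 : (2 : F) = 0) (x : ι → F) :
    x ⬝ᵥ x = (1 ⬝ᵥ x) ^ 2 := by
  have : CharP F 2 := CharTwo.of_one_ne_zero_of_two_eq_zero one_ne_zero h2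
  rw [one_dotProduct, pow_two, CharTwo.sum_mul_self]
  rfl

theorem dotProduct_self_eq_zero_iff_of_two_eq_zero (h2 : (2 : F) = 0) {x : ι → F} :
    x ⬝ᵥ x = 0 ↔ 1 ⬝ᵥ x = 0 := by
  rw [dotProduct_self_of_two_eq_zero h2, sq_eq_zero_iff]

/-- In characteristic two the dot square vanishes on `U^⊥` if and only if `1 ∈ U`. -/
theorem forall_dotProduct_self_perp_iff (h2 : (2 : F) = 0) {U : Submodule F (ι → F)} :
    (∀ x ∈ perp U, x ⬝ᵥ x = 0) ↔ 1 ∈ U := by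
  rw [← perp_perp U, mem_perp, perp_perp]
  simp_rw [dotProduct_self_eq_zero_iff_of_two_eq_zero h2, dotProduct_comm]

end Orthogonal

/-! ### Double counting and averaging over translates -/

section Counting

theorem sum_ncard_comm {α β : Type*} [Fintype α] [Fintype β] (r : α → β → Prop) :
    ∑ a, {b | r a b}.ncard = ∑ b, {a | r a b}.ncard := by
  classical
  have h := Finset.sum_card_bipartiteAbove_eq_sum_card_bipartiteBelow (s := Finset.univ)
    (t := Finset.univ) r
  simp only [Finset.bipartiteAbove, Finset.bipartiteBelow] at h
  simp only [Set.ncard_eq_toFinset_card', Set.toFinset_ofPred]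
  convert h

theorem sum_ite_const_eq_ncard_mul {α : Type*} [Fintype α] (p : α → Prop) [DecidablePred p]
    (c : ℕ) : ∑ a, (if p a then c else 0) = {a | p a}.ncard * c := by
  rw [← Finset.sum_filter, Finset.sum_const, smul_eq_mul, Set.ncard_eq_toFinset_card',
    Set.toFinset_ofPred]

variable {F V : Type*} [Field F] [Fintype F] [AddCommGroup V] [Module F V]

theorem ncard_submodule [Finite V] (W : Submodule F V) :
    (W : Set V).ncard = Fintype.card F ^ Module.finrank F W := by
  have := Fintype.ofFinite W
  rw [← Module.card_eq_pow_finrank (K := F) (V := W), ← Nat.card_eq_fintype_card,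
    ← Nat.card_coe_set_eq]
  rfl

/-- Translation by `t • w` permutes `A`, so for each `t` the shifted condition has as many solutions
as the original one. Counting on `A` thus reduces to counting along lines in direction `w`. -/
theorem card_mul_ncard_eq_sum [Fintype V] {A : Set V} {w : V}
    (hA : ∀ x ∈ A, ∀ t : F, x + t • w ∈ A) (p : V → Prop) :
    Fintype.card F * {x | x ∈ A ∧ p x}.ncard =
      ∑ x, {t : F | x ∈ A ∧ p (x + t • w)}.ncard := by
  rw [← sum_ncard_comm (fun (t : F) x => x ∈ A ∧ p (x + t • w))]
  have : ∀ t : F, {x | x ∈ A ∧ p (x + t • w)}.ncard = {x | x ∈ A ∧ p x}.ncard := by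
    intro t
    rw [← Set.ncard_image_of_injective _ (add_left_injective (t • w))]
    congr 1
    ext y
    constructor
    · rintro ⟨x, hx, rfl⟩
      exact ⟨hA x hx.1 t, hx.2⟩
    · rintro ⟨hy, hp⟩
      refine ⟨y + (-t) • w, ⟨hA y hy _, ?_⟩, ?_⟩
      · simpa using hp
      · simp
  simp [this]

theorem card_mul_ncard_le [Finite V] {A : Set V} {w : V}
    (hA : ∀ x ∈ A, ∀ t : F, x + t • w ∈ A) (p : V → Prop) (c : ℕ)
    (hc : ∀ x ∈ A, {t : F | p (x + t • w)}.ncard ≤ c) :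
    Fintype.card F * {x | x ∈ A ∧ p x}.ncard ≤ A.ncard * c := by
  classical
  have := Fintype.ofFinite V
  rw [card_mul_ncard_eq_sum hA, show A = {x | x ∈ A} from rfl, ← sum_ite_const_eq_ncard_mul]
  refine Finset.sum_le_sum fun x _ => ?_
  split_ifs with hx
  · simpa [show x ∈ A from hx] using hc x hx
  · simp [show x ∉ A from hx]

theorem card_mul_ncard_eq [Finite V] {A : Set V} {w : V}
    (hA : ∀ x ∈ A, ∀ t : F, x + t • w ∈ A) (p : V → Prop)
    (hc : ∀ x ∈ A, {t : F | p (x + t • w)}.ncard = 1) :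
    Fintype.card F * {x | x ∈ A ∧ p x}.ncard = A.ncard := by
  classical
  have := Fintype.ofFinite V
  rw [card_mul_ncard_eq_sum hA, ← mul_one A.ncard, show A = {x | x ∈ A} from rfl,
    ← sum_ite_const_eq_ncard_mul]
  refine Finset.sum_congr rfl fun x _ => ?_
  split_ifs with hx
  · simpa [show x ∈ A from hx] using hc x hx
  · simp [show x ∉ A from hx]

end Counting

/-! ### Zeros of the dot square on a subspace -/

section Zeros

variable {F ι : Type*} [Field F] [Fintype ι]

/-- The vectors of `W` with vanishing dot square. -/
def isoSet (W : Submodule F (ι → F)) : Set (ι → F) := {x | x ∈ W ∧ x ⬝ᵥ x = 0}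

theorem dotProduct_add_smul_self {x w : ι → F} (t : F) :
    (x + t • w) ⬝ᵥ (x + t • w) = x ⬝ᵥ x + t * (2 * (w ⬝ᵥ x)) + t ^ 2 * (w ⬝ᵥ w) := by
  simp only [dotProduct_add, add_dotProduct, smul_dotProduct, dotProduct_smul, smul_eq_mul]
  rw [dotProduct_comm x w]
  ring

variable [Fintype F]

theorem ncard_quadratic_roots_le (a b : F) {c : F} (hc : c ≠ 0) :
    {t : F | a + t * b + t ^ 2 * c = 0}.ncard ≤ 2 := by
  classical
  let P : Polynomial F := Polynomial.C c * Polynomial.X ^ 2 + Polynomial.C b * Polynomial.X +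
    Polynomial.C a
  have hP : P.natDegree = 2 := Polynomial.natDegree_quadratic hc
  have hP0 : P ≠ 0 := by
    intro h
    rw [h] at hP
    simp at hP
  have hsub : {t : F | a + t * b + t ^ 2 * c = 0} ⊆ (P.roots.toFinset : Set F) := by
    intro t ht
    simp only [Finset.mem_coe, Multiset.mem_toFinset, Polynomial.mem_roots hP0,
      Polynomial.IsRoot.def]
    simp only [P, Polynomial.eval_add, Polynomial.eval_mul, Polynomial.eval_C,
      Polynomial.eval_pow, Polynomial.eval_X]
    have ht' : a + t * b + t ^ 2 * c = 0 := ht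
    linear_combination ht'
  calc _ ≤ (P.roots.toFinset : Set F).ncard := Set.ncard_le_ncard hsub
    _ ≤ P.roots.card := by
      rw [Set.ncard_coe_finset]
      exact Multiset.toFinset_card_le _
    _ ≤ 2 := hP ▸ P.card_roots'

/-- A quadratic form which does not vanish on `W` has at most `2 |W| / q` zeros in `W`. -/
theorem card_mul_ncard_isoSet_le {W : Submodule F (ι → F)} (hW : ∃ w ∈ W, w ⬝ᵥ w ≠ 0) :
    Fintype.card F * (isoSet W).ncard ≤ 2 * Fintype.card F ^ Module.finrank F W := by
  obtain ⟨w, hw, hw0⟩ := hW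
  rw [← ncard_submodule, mul_comm 2]
  refine card_mul_ncard_le (A := (W : Set (ι → F))) (w := w)
    (fun x hx t => W.add_mem hx (W.smul_mem t hw)) (fun x => x ⬝ᵥ x = 0) 2 fun x _ => ?_
  -- On a line in direction `w` the dot square is a polynomial in `t` with leading coefficient `w ⬝ᵥ
  -- w ≠ 0`.
  simp_rw [dotProduct_add_smul_self]
  exact ncard_quadratic_roots_le _ _ hw0

theorem ncard_isoSet_of_selfPerp {W : Submodule F (ι → F)} (hW : SelfPerp W) :
    (isoSet W).ncard = Fintype.card F ^ Module.finrank F W := by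
  rw [← ncard_submodule]
  congr 1
  ext x
  exact ⟨fun h => h.1, fun h => ⟨h, hW.dotProduct_self h⟩⟩

/-- In odd characteristic, a singular vector `e` determines the number of singular vectors that
are not orthogonal to `e`. -/
theorem card_mul_ncard_isoSet_diff (h2 : (2 : F) ≠ 0) {U : Submodule F (ι → F)}
    {e : ι → F} (he : e ∈ perp U) (he0 : e ⬝ᵥ e = 0) :
    Fintype.card F * {x | x ∈ isoSet (perp U) ∧ e ⬝ᵥ x ≠ 0}.ncard +
      Fintype.card F ^ Module.finrank F (perp (U ⊔ Submodule.span F {e})) =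
      Fintype.card F ^ Module.finrank F (perp U) := by
  have h := card_mul_ncard_eq (F := F)
    (A := (perp U : Set (ι → F)) \ (perp (U ⊔ Submodule.span F {e}) : Set (ι → F))) (w := e)
    (fun x hx t => ⟨(perp U).add_mem hx.1 ((perp U).smul_mem t he), fun hx2 => hx.2 ?_⟩)
    (fun x => x ⬝ᵥ x = 0) (fun x hx => ?_)
  · have hsub : (perp (U ⊔ Submodule.span F {e}) : Set (ι → F)) ⊆ (perp U : Set (ι → F)) :=
      perp_anti le_sup_left
    rw [Set.ncard_sdiff hsub, ncard_submodule, ncard_submodule] at h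
    have hle := Set.ncard_le_ncard hsub
    rw [ncard_submodule, ncard_submodule] at hle
    have hset : {x | x ∈ isoSet (perp U) ∧ e ⬝ᵥ x ≠ 0} =
        {x | x ∈ (perp U : Set (ι → F)) \ (perp (U ⊔ Submodule.span F {e}) : Set (ι → F)) ∧
          x ⬝ᵥ x = 0} := by
      ext x
      simp only [isoSet, Set.mem_ofPred_eq, Set.mem_sdiff, SetLike.mem_coe, mem_perp_sup_span]
      tauto
    rw [hset]
    omega
  · rw [SetLike.mem_coe, mem_perp_sup_span] at hx2 ⊢
    refine ⟨hx.1, ?_⟩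
    have h3 := hx2.2
    rw [dotProduct_add, dotProduct_smul, he0, smul_zero, add_zero] at h3
    exact h3
  -- Since `e` is singular, the dot square is affine along `x + t • e` with nonzero slope `2 * (e ⬝ᵥ
  -- x)`, so it has exactly one zero.
  · have hx0 : e ⬝ᵥ x ≠ 0 := fun h0 => hx.2 (mem_perp_sup_span.2 ⟨hx.1, h0⟩)
    rw [Set.ncard_eq_one]
    refine ⟨-(x ⬝ᵥ x) / (2 * (e ⬝ᵥ x)), ?_⟩
    ext t
    rw [Set.mem_ofPred_eq, dotProduct_add_smul_self, he0, mul_zero, add_zero,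
      Set.mem_singleton_iff, eq_div_iff (mul_ne_zero h2 hx0)]
    constructor <;> intro h
    · linear_combination h
    · linear_combination h

theorem ncard_isoSet_perp_eq_add {U : Submodule F (ι → F)} (e : ι → F) :
    (isoSet (perp U)).ncard = {x | x ∈ isoSet (perp U) ∧ e ⬝ᵥ x ≠ 0}.ncard +
      (isoSet (perp (U ⊔ Submodule.span F {e}))).ncard := by
  rw [← Set.ncard_union_eq]
  · congr 1
    ext x
    simp only [isoSet, Set.mem_ofPred_eq, Set.mem_union, mem_perp_sup_span]
    tauto
  · rw [Set.disjoint_left]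
    intro x hx hx2
    exact hx.2 (mem_perp_sup_span.1 hx2.1).2

end Zeros

/-! ### Number of singular vectors in an orthogonal complement -/

section IsoCount

variable {F ι : Type*} [Field F] [Fintype ι]

theorem exists_mem_notMem_of_finrank_lt {V : Type*} [AddCommGroup V] [Module F V]
    [FiniteDimensional F V] {U W : Submodule F V}
    (h : Module.finrank F U < Module.finrank F W) : ∃ v ∈ W, v ∉ U := by
  by_contra! hc
  exact absurd (Submodule.finrank_mono (show W ≤ U from hc)) (not_le.2 h)

theorem exists_dotProduct_self_ne_zero (h2 : (2 : F) ≠ 0) {W : Submodule F (ι → F)}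
    (hW : Fintype.card ι < 2 * Module.finrank F W) : ∃ x ∈ W, x ⬝ᵥ x ≠ 0 := by
  by_contra! hc
  exact absurd (selfPerp_of_dotProduct_self h2 hc).two_mul_finrank_le (not_le.2 hW)

theorem isoSet_perp_of_two_eq_zero (h2 : (2 : F) = 0) (U : Submodule F (ι → F)) :
    isoSet (perp U) = (perp (U ⊔ Submodule.span F {1}) : Set (ι → F)) := by
  ext x
  rw [SetLike.mem_coe, mem_perp_sup_span, isoSet, Set.mem_ofPred_eq,
    dotProduct_self_eq_zero_iff_of_two_eq_zero h2]

variable [Fintype F]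

theorem exists_add_sq_mul_eq_zero (h2 : (2 : F) ≠ 0) {a b : F} (ha : a ≠ 0) (hb : b ≠ 0)
    (c : F) : ∃ x y : F, x ^ 2 * a + y ^ 2 * b + c = 0 := by
  have hodd : Fintype.card F % 2 = 1 := by
    apply FiniteField.odd_card_of_char_ne_two
    intro h
    apply h2
    have := ringChar.charP F
    rw [h] at this
    exact_mod_cast CharP.cast_eq_zero F 2
  obtain ⟨x, y, h⟩ := FiniteField.exists_root_sum_quadratic
    (f := Polynomial.C a * Polynomial.X ^ 2 + Polynomial.C 0 * Polynomial.X + Polynomial.C 0)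
    (g := Polynomial.C b * Polynomial.X ^ 2 + Polynomial.C 0 * Polynomial.X + Polynomial.C c)
    (Polynomial.degree_quadratic ha) (Polynomial.degree_quadratic hb) hodd
  refine ⟨x, y, ?_⟩
  simp only [Polynomial.eval_add, Polynomial.eval_mul, Polynomial.eval_C,
    Polynomial.eval_pow, Polynomial.eval_X] at h
  linear_combination h

/-- Otherwise three pairwise orthogonal vectors of `U^⊥` outside `U` could be chosen, all with
nonzero dot square, and a diagonal form in three variables over a finite field has a zero with third
coordinate 1. -/
theorem exists_isotropic_notMem (h2 : (2 : F) ≠ 0) {U : Submodule F (ι → F)}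
    (hU : 2 * Module.finrank F U + 3 ≤ Fintype.card ι) :
    ∃ e ∈ perp U, e ∉ U ∧ e ⬝ᵥ e = 0 := by
  by_contra! hc
  have h0 := finrank_perp_add U
  obtain ⟨v₁, hv₁, hv₁U⟩ := exists_mem_notMem_of_finrank_lt (U := U) (W := perp U) (by omega)
  have h1 := finrank_perp_add (U ⊔ Submodule.span F {v₁})
  rw [finrank_sup_span hv₁U] at h1
  obtain ⟨v₂, hv₂, hv₂U⟩ := exists_mem_notMem_of_finrank_lt (U := U)
    (W := perp (U ⊔ Submodule.span F {v₁})) (by omega)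
  have h3 := finrank_perp_add (U ⊔ Submodule.span F {v₁} ⊔ Submodule.span F {v₂})
  have h4 := Submodule.finrank_add_le_finrank_add_finrank (U ⊔ Submodule.span F {v₁})
    (Submodule.span F {v₂})
  have h5 := finrank_span_le_card (R := F) ({v₂} : Set (ι → F))
  rw [finrank_sup_span hv₁U] at h4
  simp only [Set.toFinset_singleton, Finset.card_singleton] at h5
  obtain ⟨v₃, hv₃, hv₃U⟩ := exists_mem_notMem_of_finrank_lt (U := U)
    (W := perp (U ⊔ Submodule.span F {v₁} ⊔ Submodule.span F {v₂})) (by omega)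
  rw [mem_perp_sup_span] at hv₂
  rw [mem_perp_sup_span, mem_perp_sup_span] at hv₃
  obtain ⟨⟨hv₃p, h13⟩, h23⟩ := hv₃
  obtain ⟨hv₂p, h12⟩ := hv₂
  obtain ⟨x, y, hxy⟩ := exists_add_sq_mul_eq_zero h2 (hc v₁ hv₁ hv₁U) (hc v₂ hv₂p hv₂U)
    (v₃ ⬝ᵥ v₃)
  have h21 : v₂ ⬝ᵥ v₁ = 0 := by rw [dotProduct_comm]; exact h12
  have h31 : v₃ ⬝ᵥ v₁ = 0 := by rw [dotProduct_comm]; exact h13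
  have h32 : v₃ ⬝ᵥ v₂ = 0 := by rw [dotProduct_comm]; exact h23
  refine hc (x • v₁ + y • v₂ + v₃) ((perp U).add_mem ((perp U).add_mem
    ((perp U).smul_mem _ hv₁) ((perp U).smul_mem _ hv₂p)) hv₃p) (fun hm => ?_) ?_
  -- If the combination lay in `U`, it would be orthogonal to `v₃ ∈ U^⊥`; but its dot product with
  -- `v₃` is `v₃ ⬝ᵥ v₃`.
  · have := mem_perp.1 hv₃p _ hm
    simp only [add_dotProduct, smul_dotProduct, h13, h23, smul_zero, zero_add] at this
    exact hc v₃ hv₃p hv₃U this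
  · simp only [add_dotProduct, smul_dotProduct, dotProduct_add, dotProduct_smul, h12, h13, h21,
      h23, h31, h32, zero_add, add_zero, smul_eq_mul, mul_zero]
    linear_combination hxy

/-- The number of singular vectors in `U^⊥`. -/
theorem card_mul_ncard_isoSet_perp {U : Submodule F (ι → F)}
    (hQ : ∃ x ∈ perp U, x ⬝ᵥ x ≠ 0) {m : ℕ}
    (hm : Module.finrank F U + 1 + m = Fintype.card ι) (hUm : Module.finrank F U + 2 ≤ m) :
    Fintype.card F ^ (m + 1) ≤ Fintype.card F * (isoSet (perp U)).ncard + Fintype.card F ^ m ∧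
      Fintype.card F * (isoSet (perp U)).ncard ≤
        Fintype.card F ^ (m + 1) + Fintype.card F ^ m := by
  by_cases h2 : (2 : F) = 0
  · have h1 : (1 : ι → F) ∉ U := by
      rw [← forall_dotProduct_self_perp_iff h2]
      push Not
      exact hQ
    have h3 := finrank_perp_add (U ⊔ Submodule.span F {1})
    rw [finrank_sup_span h1] at h3
    rw [isoSet_perp_of_two_eq_zero h2, ncard_submodule,
      show Module.finrank F (perp (U ⊔ Submodule.span F {1})) = m by omega, pow_succ, mul_comm]
    exact ⟨Nat.le_add_right _ _, Nat.le_add_right _ _⟩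
  -- Outside `(U + ⟨e⟩)^⊥` the count is exact. Inside, a space of dimension `m > n / 2` is not
  -- totally singular, so the quadratic bound leaves an error of at most `2 * q ^ (m - 1)`.
  · obtain ⟨e, he, heU, he0⟩ := exists_isotropic_notMem h2 (U := U) (by omega)
    have h3 := finrank_perp_add (U ⊔ Submodule.span F {e})
    have h4 := finrank_perp_add U
    rw [finrank_sup_span heU] at h3
    have hd := card_mul_ncard_isoSet_diff h2 he he0
    have hz := card_mul_ncard_isoSet_le
      (exists_dotProduct_self_ne_zero h2 (W := perp (U ⊔ Submodule.span F {e})) (by omega))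
    rw [show Module.finrank F (perp (U ⊔ Submodule.span F {e})) = m by omega] at hd hz
    rw [show Module.finrank F (perp U) = m + 1 by omega] at hd
    rw [ncard_isoSet_perp_eq_add e, mul_add]
    omega

/-- The number of singular vectors in `U^⊥`, if `U` is a hyperplane in a maximal
self-orthogonal space of half the dimension. -/
theorem card_mul_ncard_isoSet_perp_of_hyperplane (h2 : (2 : F) ≠ 0) {U : Submodule F (ι → F)}
    (hU : SelfPerp U) {m : ℕ} (hm : Module.finrank F U = m) (hn : Fintype.card ι = 2 * (m + 1))
    {e : ι → F} (he : e ∈ perp U) (he0 : e ⬝ᵥ e = 0) (heU : e ∉ U) :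
    (isoSet (perp U)).ncard + Fintype.card F ^ m = 2 * Fintype.card F ^ (m + 1) := by
  have h3 := finrank_perp_add (U ⊔ Submodule.span F {e})
  have h4 := finrank_perp_add U
  rw [finrank_sup_span heU] at h3
  have hd := card_mul_ncard_isoSet_diff h2 he he0
  have hs : SelfPerp (U ⊔ Submodule.span F {e}) := (selfPerp_sup_span hU).2 ⟨he, he0⟩
  -- `U + ⟨e⟩` has half the dimension, hence is its own orthogonal, and all `q ^ (m + 1)` of its
  -- vectors are singular.
  have heq : perp (U ⊔ Submodule.span F {e}) = U ⊔ Submodule.span F {e} := by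
    symm
    apply Submodule.eq_of_le_of_finrank_le hs
    rw [finrank_sup_span heU]
    omega
  have hz := ncard_isoSet_of_selfPerp hs
  rw [finrank_sup_span heU, hm] at hz
  rw [show Module.finrank F (perp (U ⊔ Submodule.span F {e})) = m + 1 by omega,
    show Module.finrank F (perp U) = m + 2 by omega] at hd
  rw [ncard_isoSet_perp_eq_add e, heq, hz]
  have hq : 0 < Fintype.card F := Fintype.card_pos
  have h5 : {x | x ∈ isoSet (perp U) ∧ e ⬝ᵥ x ≠ 0}.ncard + Fintype.card F ^ m =
      Fintype.card F ^ (m + 1) := by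
    apply Nat.eq_of_mul_eq_mul_left hq
    rw [mul_add, ← pow_succ', ← pow_succ', hd]
  omega

end IsoCount

/-! ### Counting the members of a convex family above a given space -/

section Extensions

variable {F V : Type*} [Field F] [AddCommGroup V] [Module F V]

/-- The number of `k`-dimensional members of the family `G` that contain `U`. -/
def extCount (G : Submodule F V → Prop) (k : ℕ) (U : Submodule F V) : ℕ :=
  {C : Submodule F V | Module.finrank F C = k ∧ G C ∧ U ≤ C}.ncard

/-- The number of vectors by which `U` can be extended within the family `G`. -/
def stepCount (G : Submodule F V → Prop) (U : Submodule F V) : ℕ :=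
  {v : V | v ∉ U ∧ G (U ⊔ Submodule.span F {v})}.ncard

/-- A family of subspaces is convex if it contains everything between two of its members. -/
def ConvexFamily (G : Submodule F V → Prop) : Prop :=
  ∀ U W C, G U → G C → U ≤ W → W ≤ C → G W

variable {G : Submodule F V → Prop} {k : ℕ}

theorem sum_ite_const_eq_stepCount_mul [Fintype V] (U : Submodule F V)
    [DecidablePred fun v : V => v ∉ U ∧ G (U ⊔ Submodule.span F {v})] (c : ℝ) :
    ∑ v : V, (if v ∉ U ∧ G (U ⊔ Submodule.span F {v}) then c else 0) = stepCount G U * c := by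
  rw [← Finset.sum_filter, Finset.sum_const, nsmul_eq_mul, stepCount,
    Set.ncard_eq_toFinset_card', Set.toFinset_ofPred]

variable [Finite V]

theorem extCount_eq_zero (hG : ConvexFamily G) {U W : Submodule F V} (hU : G U) (hUW : U ≤ W)
    (hW : ¬ G W) : extCount G k W = 0 := by
  unfold extCount
  rw [Set.ncard_eq_zero (Set.toFinite _), Set.eq_empty_iff_forall_notMem]
  exact fun C h => hW (hG U W C hU h.2.1 hUW h.2.2)


theorem extCount_self {U : Submodule F V} (hU : G U) :
    extCount G (Module.finrank F U) U = 1 := by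
  unfold extCount
  rw [Set.ncard_eq_one]
  refine ⟨U, ?_⟩
  ext C
  rw [Set.mem_ofPred_eq, Set.mem_singleton_iff]
  constructor
  · rintro ⟨h1, -, h2⟩
    exact (Submodule.eq_of_le_of_finrank_eq h2 h1.symm).symm
  · rintro rfl
    exact ⟨rfl, hU, le_rfl⟩

variable [Fintype F]

/-- Double count pairs `(v, C)` with `v ∈ C \ U`: each `C` contributes `q ^ k - q ^ dim U` vectors.
Convexity discards the `v` for which `U + ⟨v⟩` leaves the family. -/
theorem extCount_mul (hG : ConvexFamily G) {U : Submodule F V} (hU : G U) [Fintype V]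
    [DecidablePred fun v : V => v ∉ U ∧ G (U ⊔ Submodule.span F {v})] :
    extCount G k U * (Fintype.card F ^ k - Fintype.card F ^ Module.finrank F U) =
      ∑ v : V, if v ∉ U ∧ G (U ⊔ Submodule.span F {v}) then
        extCount G k (U ⊔ Submodule.span F {v}) else 0 := by
  classical
  have := Fintype.ofFinite (Submodule F V)
  have h := sum_ncard_comm fun (v : V) (C : Submodule F V) =>
    (v ∉ U ∧ v ∈ C) ∧ Module.finrank F C = k ∧ G C ∧ U ≤ C
  rw [extCount, ← sum_ite_const_eq_ncard_mul]
  symm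
  convert h using 2 with v _ C _
  · split_ifs with hv
    · unfold extCount
      congr 1
      ext C
      simp only [Set.mem_ofPred_eq, sup_le_iff, Submodule.span_singleton_le_iff_mem]
      tauto
    · symm
      rw [Set.ncard_eq_zero (Set.toFinite _), Set.eq_empty_iff_forall_notMem]
      rintro C ⟨⟨h1, h2⟩, -, h3, h4⟩
      refine hv ⟨h1, hG U _ C hU h3 le_sup_left ?_⟩
      exact sup_le h4 ((Submodule.span_singleton_le_iff_mem _ _).2 h2)
  · split_ifs with hC
    · have hsub : (U : Set V) ⊆ (C : Set V) := hC.2.2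
      have h1 := Set.ncard_sdiff hsub
      rw [ncard_submodule, ncard_submodule, hC.1] at h1
      rw [← h1]
      congr 1
      ext v
      simp only [Set.mem_sdiff, SetLike.mem_coe, Set.mem_ofPred_eq]
      tauto
    · symm
      rw [Set.ncard_eq_zero (Set.toFinite _), Set.eq_empty_iff_forall_notMem]
      rintro v ⟨⟨-, -⟩, h⟩
      exact hC h

/-- The main term in the count of extensions, if a space of dimension `i` can be extended by
`A i` vectors. -/
def extMain (q : ℝ) (A : ℕ → ℝ) (k j : ℕ) : ℝ :=
  ∏ i ∈ Finset.Ico j k, A i / (q ^ k - q ^ i)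

theorem extMain_self (q : ℝ) (A : ℕ → ℝ) (k : ℕ) : extMain q A k k = 1 := by
  simp [extMain]

theorem extMain_mul {q : ℝ} (hq : 1 < q) (A : ℕ → ℝ) {k j : ℕ} (hj : j < k) :
    extMain q A k j * (q ^ k - q ^ j) = A j * extMain q A k (j + 1) := by
  have h : q ^ k - q ^ j ≠ 0 := sub_ne_zero.2 (pow_lt_pow_right₀ hq hj).ne'
  rw [extMain, Finset.prod_eq_prod_Ico_succ_bot hj, extMain]
  field_simp

theorem extMain_pos {q : ℝ} (hq : 1 < q) {A : ℕ → ℝ} {k j : ℕ}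
    (hA : ∀ i, j ≤ i → i < k → 0 < A i) : 0 < extMain q A k j := by
  refine Finset.prod_pos fun i hi => ?_
  rw [Finset.mem_Ico] at hi
  exact div_pos (hA i hi.1 hi.2) (sub_pos.2 (pow_lt_pow_right₀ hq hi.2))

theorem extCount_mul_real (hG : ConvexFamily G) {U : Submodule F V} (hU : G U)
    (hk : Module.finrank F U ≤ k) [Fintype V]
    [DecidablePred fun v : V => v ∉ U ∧ G (U ⊔ Submodule.span F {v})] :
    (extCount G k U : ℝ) * ((Fintype.card F : ℝ) ^ k -
        (Fintype.card F : ℝ) ^ Module.finrank F U) =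
      ∑ v : V, if v ∉ U ∧ G (U ⊔ Submodule.span F {v}) then
        (extCount G k (U ⊔ Submodule.span F {v}) : ℝ) else 0 := by
  have h := extCount_mul (k := k) hG hU
  have h2 := congrArg (Nat.cast : ℕ → ℝ) h
  rw [Nat.cast_mul, Nat.cast_sub (Nat.pow_le_pow_right Fintype.card_pos hk)] at h2
  push_cast at h2
  exact h2

/-- Descending induction on the dimension with `extCount_mul`; each of the `k - j` steps costs one
factor `b`. Starting at `i₀` allows families whose members all contain a fixed space. -/
theorem extCount_le (hG : ConvexFamily G) {A : ℕ → ℝ} {b : ℝ} {i₀ : ℕ} (hb : 0 ≤ b)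
    (hA : ∀ i, i₀ ≤ i → i < k → 0 < A i)
    (hstep : ∀ U : Submodule F V, G U → i₀ ≤ Module.finrank F U → Module.finrank F U < k →
      (stepCount G U : ℝ) ≤ b * A (Module.finrank F U)) {j : ℕ} (hj : j ≤ k) :
    ∀ U : Submodule F V, G U → i₀ ≤ Module.finrank F U → Module.finrank F U = j →
      (extCount G k U : ℝ) ≤ b ^ (k - j) * extMain (Fintype.card F) A k j := by
  classical
  have := Fintype.ofFinite V
  have hq : (1 : ℝ) < Fintype.card F := by exact_mod_cast Fintype.one_lt_card
  induction hj using Nat.decreasingInduction with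
  | self =>
    intro U hU _ hj
    rw [extMain_self, ← hj, extCount_self hU]
    simp
  | of_succ j hjk ih =>
    intro U hU hi hj
    have hpos : (0 : ℝ) < (Fintype.card F : ℝ) ^ k - (Fintype.card F : ℝ) ^ j :=
      sub_pos.2 (pow_lt_pow_right₀ hq hjk)
    have h1 := extCount_mul_real (k := k) hG hU (by omega)
    rw [hj] at h1
    refine le_of_mul_le_mul_right ?_ hpos
    have hsum : ∑ v : V, (if v ∉ U ∧ G (U ⊔ Submodule.span F {v}) then
          (extCount G k (U ⊔ Submodule.span F {v}) : ℝ) else 0) ≤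
        ∑ v : V, (if v ∉ U ∧ G (U ⊔ Submodule.span F {v}) then
          b ^ (k - (j + 1)) * extMain (Fintype.card F) A k (j + 1) else 0) := by
      refine Finset.sum_le_sum fun v _ => ?_
      split_ifs with hv
      · have h3 := finrank_sup_span hv.1
        exact ih _ hv.2 (by omega) (by omega)
      · exact le_rfl
    rw [sum_ite_const_eq_stepCount_mul] at hsum
    have hE := extMain_pos hq (A := A) (k := k) (j := j + 1) fun i h1 h2 => hA i (by omega) h2
    have hs := hstep U hU hi (by omega)
    rw [hj] at hs
    calc _ ≤ (stepCount G U : ℝ) * (b ^ (k - (j + 1)) * extMain (Fintype.card F) A k (j + 1)) :=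
          h1 ▸ hsum
      _ ≤ (b * A j) * (b ^ (k - (j + 1)) * extMain (Fintype.card F) A k (j + 1)) := by
          gcongr
      _ = b ^ (k - j) * (A j * extMain (Fintype.card F) A k (j + 1)) := by
          rw [show k - j = k - (j + 1) + 1 by omega, pow_succ]
          ring
      _ = _ := by rw [← extMain_mul hq A hjk, mul_assoc]

theorem le_extCount (hG : ConvexFamily G) {A : ℕ → ℝ} {a : ℝ} {i₀ : ℕ} (ha : 0 ≤ a)
    (hA : ∀ i, i₀ ≤ i → i < k → 0 < A i)
    (hstep : ∀ U : Submodule F V, G U → i₀ ≤ Module.finrank F U → Module.finrank F U < k →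
      a * A (Module.finrank F U) ≤ (stepCount G U : ℝ)) {j : ℕ} (hj : j ≤ k) :
    ∀ U : Submodule F V, G U → i₀ ≤ Module.finrank F U → Module.finrank F U = j →
      a ^ (k - j) * extMain (Fintype.card F) A k j ≤ (extCount G k U : ℝ) := by
  classical
  have := Fintype.ofFinite V
  have hq : (1 : ℝ) < Fintype.card F := by exact_mod_cast Fintype.one_lt_card
  induction hj using Nat.decreasingInduction with
  | self =>
    intro U hU _ hj
    rw [extMain_self, ← hj, extCount_self hU]
    simp
  | of_succ j hjk ih =>
    intro U hU hi hj
    have hpos : (0 : ℝ) < (Fintype.card F : ℝ) ^ k - (Fintype.card F : ℝ) ^ j :=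
      sub_pos.2 (pow_lt_pow_right₀ hq hjk)
    have h1 := extCount_mul_real (k := k) hG hU (by omega)
    rw [hj] at h1
    refine le_of_mul_le_mul_right ?_ hpos
    have hsum : ∑ v : V, (if v ∉ U ∧ G (U ⊔ Submodule.span F {v}) then
          a ^ (k - (j + 1)) * extMain (Fintype.card F) A k (j + 1) else 0) ≤
        ∑ v : V, (if v ∉ U ∧ G (U ⊔ Submodule.span F {v}) then
          (extCount G k (U ⊔ Submodule.span F {v}) : ℝ) else 0) := by
      refine Finset.sum_le_sum fun v _ => ?_
      split_ifs with hv
      · have h3 := finrank_sup_span hv.1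
        exact ih _ hv.2 (by omega) (by omega)
      · exact le_rfl
    rw [sum_ite_const_eq_stepCount_mul] at hsum
    have hE := extMain_pos hq (A := A) (k := k) (j := j + 1) fun i h1 h2 => hA i (by omega) h2
    have hs := hstep U hU hi (by omega)
    rw [hj] at hs
    calc _ = a ^ (k - j) * (A j * extMain (Fintype.card F) A k (j + 1)) := by
          rw [← extMain_mul hq A hjk, mul_assoc]
      _ = (a * A j) * (a ^ (k - (j + 1)) * extMain (Fintype.card F) A k (j + 1)) := by
          rw [show k - j = k - (j + 1) + 1 by omega, pow_succ]
          ring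
      _ ≤ (stepCount G U : ℝ) * (a ^ (k - (j + 1)) * extMain (Fintype.card F) A k (j + 1)) := by
          gcongr
      _ ≤ _ := h1 ▸ hsum

end Extensions

/-! ### Proportion of members through one or two further vectors -/

section Regular

variable {F V : Type*} [Field F] [AddCommGroup V] [Module F V] [Finite V] [Fintype F]

/-- In the ratio of the counts above `U` and above `U₀`, the main terms share all factors except
those of the first one or two steps. Hence only `A i₀` and `A (i₀ + 1)` need explicit values; the
later `A i` may be anything positive. -/
theorem extCount_regular {G : Submodule F V → Prop} {k n i₀ : ℕ} (hG : ConvexFamily G)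
    {U₀ : Submodule F V} (hU₀ : G U₀) (hi₀ : Module.finrank F U₀ = i₀) (hk : i₀ + 2 ≤ k)
    {A : ℕ → ℝ} {a b : ℝ} (ha : 0 < a) (ha1 : a ≤ 1) (hb : 1 ≤ b)
    (hA : ∀ i, i₀ ≤ i → i < k → 0 < A i)
    (hA0 : A i₀ = (Fintype.card F : ℝ) ^ (n - 1))
    (hA1 : A (i₀ + 1) = (Fintype.card F : ℝ) ^ (n - 2))
    (hstep : ∀ U : Submodule F V, G U → i₀ ≤ Module.finrank F U → Module.finrank F U < k →
      a * A (Module.finrank F U) ≤ (stepCount G U : ℝ) ∧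
      (stepCount G U : ℝ) ≤ b * A (Module.finrank F U)) :
    0 < extCount G k U₀ ∧
    (∀ U : Submodule F V, U₀ ≤ U → Module.finrank F U = i₀ + 1 →
      (extCount G k U : ℝ) * (Fintype.card F : ℝ) ^ (n - 1) ≤
        (b / a) ^ k * (Fintype.card F : ℝ) ^ k * extCount G k U₀) ∧
    (∀ U : Submodule F V, G U → Module.finrank F U = i₀ + 1 →
      (a / b) ^ k * ((Fintype.card F : ℝ) ^ k - (Fintype.card F : ℝ) ^ i₀) * extCount G k U₀ ≤
        (extCount G k U : ℝ) * (Fintype.card F : ℝ) ^ (n - 1)) ∧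
    (∀ U : Submodule F V, U₀ ≤ U → Module.finrank F U = i₀ + 2 →
      (extCount G k U : ℝ) * ((Fintype.card F : ℝ) ^ (n - 1) * (Fintype.card F : ℝ) ^ (n - 2)) ≤
        (b / a) ^ k * ((Fintype.card F : ℝ) ^ k * (Fintype.card F : ℝ) ^ k) *
          extCount G k U₀) := by
  have hq : (1 : ℝ) < Fintype.card F := by exact_mod_cast Fintype.one_lt_card
  set q : ℝ := (Fintype.card F : ℝ) with hqdef
  have hq0 : 0 < q := by linarith
  have hb0 : 0 < b := by linarith
  have hlow : ∀ {j : ℕ}, j ≤ k → ∀ U : Submodule F V, G U → i₀ ≤ Module.finrank F U →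
      Module.finrank F U = j → a ^ (k - j) * extMain q A k j ≤ (extCount G k U : ℝ) :=
    le_extCount hG ha.le hA fun U h1 h2 h3 => (hstep U h1 h2 h3).1
  have hup : ∀ {j : ℕ}, j ≤ k → ∀ U : Submodule F V, G U → i₀ ≤ Module.finrank F U →
      Module.finrank F U = j → (extCount G k U : ℝ) ≤ b ^ (k - j) * extMain q A k j :=
    extCount_le hG hb0.le hA fun U h1 h2 h3 => (hstep U h1 h2 h3).2
  have hE0 := extMain_pos hq (A := A) (k := k) (j := i₀) hA
  have hE1 := extMain_pos hq (A := A) (k := k) (j := i₀ + 1) fun i h1 h2 => hA i (by omega) h2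
  have hE2 := extMain_pos hq (A := A) (k := k) (j := i₀ + 2) fun i h1 h2 => hA i (by omega) h2
  have hm0 := extMain_mul hq A (show i₀ < k by omega)
  have hm1 := extMain_mul hq A (show i₀ + 1 < k by omega)
  rw [hA0] at hm0
  rw [hA1] at hm1
  have hpa : ∀ i, a ^ k ≤ a ^ (k - i) := fun i =>
    pow_le_pow_of_le_one ha.le ha1 (Nat.sub_le _ _)
  have hpb : ∀ i, b ^ (k - i) ≤ b ^ k := fun i => pow_le_pow_right₀ hb (Nat.sub_le _ _)
  have hN := hlow (j := i₀) (by omega) U₀ hU₀ hi₀.ge hi₀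
  have hN2 := hup (j := i₀) (by omega) U₀ hU₀ hi₀.ge hi₀
  have hN' : extMain q A k i₀ ≤ extCount G k U₀ / a ^ k := by
    rw [le_div_iff₀ (pow_pos ha k), mul_comm]
    exact (mul_le_mul_of_nonneg_right (hpa _) hE0.le).trans hN
  have hN2' : extCount G k U₀ / b ^ k ≤ extMain q A k i₀ := by
    rw [div_le_iff₀ (pow_pos hb0 k), mul_comm]
    exact hN2.trans (mul_le_mul_of_nonneg_right (hpb _) hE0.le)
  have hk1 : (0 : ℝ) ≤ q ^ k - q ^ i₀ :=
    (sub_pos.2 (pow_lt_pow_right₀ hq (by omega))).le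
  have hk2 : (0 : ℝ) ≤ q ^ k - q ^ (i₀ + 1) :=
    (sub_pos.2 (pow_lt_pow_right₀ hq (by omega))).le
  have hk1' : q ^ k - q ^ i₀ ≤ q ^ k := sub_le_self _ (by positivity)
  have hk2' : q ^ k - q ^ (i₀ + 1) ≤ q ^ k := sub_le_self _ (by positivity)
  refine ⟨?_, ?_, ?_, ?_⟩
  · have : (0 : ℝ) < extCount G k U₀ := lt_of_lt_of_le (by positivity) hN
    exact_mod_cast this
  · intro U hU hj
    by_cases hGU : G U
    · have h1 := hup (j := i₀ + 1) (by omega) U hGU (by omega) hj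
      calc _ ≤ (b ^ k * extMain q A k (i₀ + 1)) * q ^ (n - 1) := by
            gcongr
            exact h1.trans (mul_le_mul_of_nonneg_right (hpb _) hE1.le)
        _ = b ^ k * (extMain q A k i₀ * (q ^ k - q ^ i₀)) := by rw [hm0]; ring
        _ ≤ b ^ k * ((extCount G k U₀ / a ^ k) * q ^ k) := by gcongr
        _ = _ := by rw [div_pow]; ring
    · rw [extCount_eq_zero hG hU₀ hU hGU, Nat.cast_zero, zero_mul]
      positivity
  · intro U hGU hj
    have h1 := hlow (j := i₀ + 1) (by omega) U hGU (by omega) hj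
    calc _ = a ^ k * ((extCount G k U₀ / b ^ k) * (q ^ k - q ^ i₀)) := by rw [div_pow]; ring
      _ ≤ a ^ k * (extMain q A k i₀ * (q ^ k - q ^ i₀)) := by gcongr
      _ = (a ^ k * extMain q A k (i₀ + 1)) * q ^ (n - 1) := by rw [hm0]; ring
      _ ≤ _ := by
        gcongr
        exact (mul_le_mul_of_nonneg_right (hpa _) hE1.le).trans h1
  · intro U hU hj
    by_cases hGU : G U
    · have h1 := hup (j := i₀ + 2) (by omega) U hGU (by omega) hj
      calc _ ≤ (b ^ k * extMain q A k (i₀ + 2)) * (q ^ (n - 1) * q ^ (n - 2)) := by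
            gcongr
            exact h1.trans (mul_le_mul_of_nonneg_right (hpb _) hE2.le)
        _ = b ^ k * ((q ^ (n - 1) * extMain q A k (i₀ + 1)) * (q ^ k - q ^ (i₀ + 1))) := by
            rw [mul_assoc (q ^ (n - 1)), hm1]; ring
        _ = b ^ k * (extMain q A k i₀ * (q ^ k - q ^ i₀) * (q ^ k - q ^ (i₀ + 1))) := by
            rw [hm0]
        _ ≤ b ^ k * ((extCount G k U₀ / a ^ k) * q ^ k * q ^ k) := by gcongr
        _ = _ := by rw [div_pow]; ring
    · rw [extCount_eq_zero hG hU₀ hU hGU, Nat.cast_zero, zero_mul]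
      positivity

end Regular

/-! ### The three families of codes and their extension numbers -/

section Families

variable {F ι : Type*} [Field F] [Fintype ι]

/-- The self-orthogonal spaces `U` for which `U^⊥` is not totally singular. -/
def NonsingularPerp (U : Submodule F (ι → F)) : Prop :=
  SelfPerp U ∧ ∃ x ∈ perp U, x ⬝ᵥ x ≠ 0

/-- The self-orthogonal spaces that contain the all-one vector. -/
def SelfPerpOne (U : Submodule F (ι → F)) : Prop := SelfPerp U ∧ 1 ∈ U

theorem convexFamily_selfPerp : ConvexFamily (SelfPerp (F := F) (ι := ι)) :=
  fun _ _ _ _ hC _ hWC => hC.mono hWC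

theorem convexFamily_nonsingularPerp : ConvexFamily (NonsingularPerp (F := F) (ι := ι)) := by
  rintro U W C - ⟨hC, x, hx, hx0⟩ - hWC
  exact ⟨hC.mono hWC, x, perp_anti hWC hx, hx0⟩

theorem convexFamily_selfPerpOne : ConvexFamily (SelfPerpOne (F := F) (ι := ι)) :=
  fun _ _ _ hU hC hUW hWC => ⟨hC.1.mono hWC, hUW hU.2⟩

/-- In characteristic 2 the orthogonal is totally singular iff the space contains `1`; since `1 ∉
U`, adjoining `v` can only produce `1` if `v ∈ U + ⟨1⟩`. In odd characteristic the new orthogonal is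
too large to be totally singular. -/
theorem nonsingularPerp_sup_span {U : Submodule F (ι → F)} (hU : NonsingularPerp U)
    {v : ι → F} (hv : v ∈ isoSet (perp U)) (hv1 : v ∉ U ⊔ Submodule.span F {1})
    (hn : 2 * Module.finrank F U + 3 ≤ Fintype.card ι) :
    NonsingularPerp (U ⊔ Submodule.span F {v}) := by
  refine ⟨(selfPerp_sup_span hU.1).2 hv, ?_⟩
  have hvU : v ∉ U := fun h => hv1 (Submodule.mem_sup_left h)
  by_cases h2 : (2 : F) = 0
  · have h1 : (1 : ι → F) ∉ U := by
      rw [← forall_dotProduct_self_perp_iff h2]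
      push Not
      exact hU.2
    by_contra! hc
    rw [forall_dotProduct_self_perp_iff h2] at hc
    obtain ⟨u, hu, w, hw, h⟩ := Submodule.mem_sup.1 hc
    obtain ⟨c, rfl⟩ := Submodule.mem_span_singleton.1 hw
    have hc0 : c ≠ 0 := by
      rintro rfl
      rw [zero_smul, add_zero] at h
      exact h1 (h ▸ hu)
    apply hv1
    have : v = c⁻¹ • (-u) + c⁻¹ • (1 : ι → F) := by
      rw [← h, smul_add, smul_smul, inv_mul_cancel₀ hc0]
      simp
    rw [this]
    exact Submodule.add_mem_sup (U.smul_mem _ (U.neg_mem hu))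
      (Submodule.smul_mem _ _ (Submodule.mem_span_singleton_self _))
  · apply exists_dotProduct_self_ne_zero h2
    have h3 := finrank_perp_add (U ⊔ Submodule.span F {v})
    rw [finrank_sup_span hvU] at h3
    omega

theorem finrank_sup_span_le {V : Type*} [AddCommGroup V] [Module F V] [FiniteDimensional F V]
    (U : Submodule F V) (v : V) :
    Module.finrank F ↥(U ⊔ Submodule.span F {v}) ≤ Module.finrank F U + 1 := by
  have h4 := Submodule.finrank_add_le_finrank_add_finrank U (Submodule.span F {v})
  have h5 := finrank_span_le_card (R := F) ({v} : Set V)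
  simp only [Set.toFinset_singleton, Finset.card_singleton] at h5
  omega

variable [Fintype F]

theorem stepCount_le_of_selfPerp {G : Submodule F (ι → F) → Prop}
    (hG : ∀ U, G U → SelfPerp U) {U : Submodule F (ι → F)} (hU : G U) :
    stepCount G U ≤ (isoSet (perp U)).ncard :=
  Set.ncard_le_ncard fun _ hv => (selfPerp_sup_span (hG U hU)).1 (hG _ hv.2)

theorem ncard_isoSet_le_stepCount {G : Submodule F (ι → F) → Prop}
    {U W : Submodule F (ι → F)} (hUW : U ≤ W)
    (h : ∀ v ∈ isoSet (perp U), v ∉ W → G (U ⊔ Submodule.span F {v})) :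
    (isoSet (perp U)).ncard ≤ stepCount G U + Fintype.card F ^ Module.finrank F W := by
  rw [← ncard_submodule]
  refine le_trans (Set.ncard_le_ncard fun v hv => ?_) (Set.ncard_union_le _ _)
  by_cases hvW : v ∈ W
  · exact Or.inr hvW
  · exact Or.inl ⟨fun hvU => hvW (hUW hvU), h v hv hvW⟩

/-- The admissible vectors are the singular ones of `U^⊥`, except for some inside `U + ⟨1⟩`.
Discarding all of that space costs at most one further `q ^ m` after multiplication by `q`. -/
theorem stepCount_nonsingularPerp {U : Submodule F (ι → F)} (hU : NonsingularPerp U) {m : ℕ}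
    (hm : Module.finrank F U + 1 + m = Fintype.card ι) (hUm : Module.finrank F U + 2 ≤ m) :
    Fintype.card F ^ (m + 1) ≤
        Fintype.card F * stepCount NonsingularPerp U + 2 * Fintype.card F ^ m ∧
      Fintype.card F * stepCount NonsingularPerp U ≤
        Fintype.card F ^ (m + 1) + Fintype.card F ^ m := by
  have h1 := card_mul_ncard_isoSet_perp hU.2 hm hUm
  have h2 := stepCount_le_of_selfPerp (G := NonsingularPerp) (fun U h => h.1) hU
  have h3 := ncard_isoSet_le_stepCount (G := NonsingularPerp) (U := U)
    (W := U ⊔ Submodule.span F {1}) le_sup_left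
    fun v hv hv1 => nonsingularPerp_sup_span hU hv hv1 (by omega)
  have h4 := finrank_sup_span_le U (1 : ι → F)
  have h5 : Fintype.card F * Fintype.card F ^ Module.finrank F ↥(U ⊔ Submodule.span F {1}) ≤
      Fintype.card F ^ m := by
    rw [← pow_succ']
    exact Nat.pow_le_pow_right Fintype.card_pos (by omega)
  have h6 := Nat.mul_le_mul_left (Fintype.card F) h3
  have h7 := Nat.mul_le_mul_left (Fintype.card F) h2
  rw [mul_add] at h6
  omega

theorem stepCount_selfPerp (h2 : (2 : F) ≠ 0) {U : Submodule F (ι → F)} (hU : SelfPerp U)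
    {m : ℕ} (hm : Module.finrank F U + 1 + m = Fintype.card ι)
    (hUm : Module.finrank F U + 2 ≤ m) :
    Fintype.card F ^ (m + 1) ≤
        Fintype.card F * stepCount SelfPerp U + 2 * Fintype.card F ^ m ∧
      Fintype.card F * stepCount SelfPerp U ≤
        Fintype.card F ^ (m + 1) + Fintype.card F ^ m := by
  have h0 := finrank_perp_add U
  have h1 := card_mul_ncard_isoSet_perp (exists_dotProduct_self_ne_zero h2 (W := perp U)
    (by omega)) hm hUm
  have h2 := stepCount_le_of_selfPerp (G := SelfPerp) (fun U h => h) hU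
  have h3 := ncard_isoSet_le_stepCount (G := SelfPerp) (le_refl U)
    fun v hv hv1 => (selfPerp_sup_span hU).2 hv
  have h5 : Fintype.card F * Fintype.card F ^ Module.finrank F U ≤ Fintype.card F ^ m := by
    rw [← pow_succ']
    exact Nat.pow_le_pow_right Fintype.card_pos (by omega)
  have h6 := Nat.mul_le_mul_left (Fintype.card F) h3
  have h7 := Nat.mul_le_mul_left (Fintype.card F) h2
  rw [mul_add] at h6
  omega

/-- A single self-dual `C` lets every self-orthogonal `U` of dimension `m` be extended: by
dimensions `U^⊥ ∩ C` is strictly larger than `U ∩ C`, which supplies a singular vector of `U^⊥`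
outside `U`. The resulting number corresponds to exactly two self-dual codes above `U`. -/
theorem stepCount_selfPerp_of_hyperplane (h2 : (2 : F) ≠ 0) {U C : Submodule F (ι → F)}
    (hU : SelfPerp U) {m : ℕ} (hm : Module.finrank F U = m)
    (hn : Fintype.card ι = 2 * (m + 1)) (hC : SelfPerp C) (hCm : Module.finrank F C = m + 1) :
    stepCount SelfPerp U + 2 * Fintype.card F ^ m = 2 * Fintype.card F ^ (m + 1) := by
  obtain ⟨e, he, heU⟩ : ∃ e ∈ perp U ⊓ C, e ∉ U ⊓ C := by
    apply exists_mem_notMem_of_finrank_lt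
    have h1 := Submodule.finrank_sup_add_finrank_inf_eq (perp U) C
    have h3 := finrank_perp_add U
    have h4 := finrank_perp_add (U ⊓ C)
    have h5 : perp U ⊔ C ≤ perp (U ⊓ C) :=
      sup_le (perp_anti inf_le_left) (le_trans hC (perp_anti inf_le_right))
    have h6 := Submodule.finrank_mono h5
    omega
  have h1 := card_mul_ncard_isoSet_perp_of_hyperplane h2 hU hm hn he.1
    (hC.dotProduct_self he.2) fun h => heU ⟨h, he.2⟩
  have hsub : (U : Set (ι → F)) ⊆ isoSet (perp U) := fun u hu => ⟨hU hu, hU.dotProduct_self hu⟩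
  have h3 := Set.ncard_sdiff_add_ncard_of_subset hsub
  rw [ncard_submodule, hm] at h3
  have h4 : stepCount SelfPerp U = (isoSet (perp U) \ (U : Set (ι → F))).ncard := by
    unfold stepCount
    congr 1
    ext v
    rw [Set.mem_ofPred_eq, selfPerp_sup_span hU, Set.mem_sdiff, and_comm]
    rfl
  omega

/-- Because `1 ∈ U`, every vector of `U^⊥` is singular in characteristic 2, so the admissible
vectors are exactly `U^⊥ \ U`. -/
theorem stepCount_selfPerpOne (h2 : (2 : F) = 0) {U : Submodule F (ι → F)}
    (hU : SelfPerpOne U) :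
    stepCount SelfPerpOne U + Fintype.card F ^ Module.finrank F U =
      Fintype.card F ^ (Fintype.card ι - Module.finrank F U) := by
  have hsub : (U : Set (ι → F)) ⊆ (perp U : Set (ι → F)) := hU.1
  have h3 := Set.ncard_sdiff_add_ncard_of_subset hsub
  have h0 := finrank_perp_add U
  rw [ncard_submodule, ncard_submodule,
    show Module.finrank F (perp U) = Fintype.card ι - Module.finrank F U by omega] at h3
  rw [← h3, stepCount]
  congr 2
  ext v
  have h4 : v ∈ perp U → v ⬝ᵥ v = 0 :=
    (forall_dotProduct_self_perp_iff h2).2 hU.2 v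
  have h5 : (1 : ι → F) ∈ U ⊔ Submodule.span F {v} := Submodule.mem_sup_left hU.2
  rw [Set.mem_ofPred_eq, SelfPerpOne, selfPerp_sup_span hU.1, Set.mem_sdiff]
  simp only [SetLike.mem_coe]
  tauto

end Families

/-! ### Singular vectors with prescribed support -/

section Support

/-- Identifies vectors supported in `S` with functions on `S`, so that the counts for an arbitrary
index type apply with `S` as index type. -/
theorem ncard_restrict {F ι : Type*} [Field F] (S : Finset ι) (p : (S → F) → Prop) :
    {v : ι → F | (∀ i, i ∉ S → v i = 0) ∧ p (S.restrict v)}.ncard = {u | p u}.ncard := by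
  classical
  have hinj : Set.InjOn S.restrict
      {v : ι → F | (∀ i, i ∉ S → v i = 0) ∧ p (S.restrict v)} := by
    intro v hv w hw h
    ext i
    by_cases hi : i ∈ S
    · exact congrFun h ⟨i, hi⟩
    · rw [hv.1 i hi, hw.1 i hi]
  rw [← hinj.ncard_image]
  congr 1
  ext u
  constructor
  · rintro ⟨v, hv, rfl⟩
    exact hv.2
  · intro hu
    have h : S.restrict (fun i => if h : i ∈ S then u ⟨i, h⟩ else 0) = u := by
      ext i
      simp
    refine ⟨_, ⟨fun i hi => ?_, ?_⟩, h⟩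
    · simp [hi]
    · rw [h]
      exact hu

variable {F ι : Type*} [Field F] [Fintype ι]

/-- The singular vectors with support in `S`. -/
def isoSupp (F : Type*) [Field F] {ι : Type*} [Fintype ι] (S : Finset ι) : Set (ι → F) :=
  {v | (∀ i, i ∉ S → v i = 0) ∧ v ⬝ᵥ v = 0}

/-- The singular vectors with support `S`. -/
def isoSuppEq (F : Type*) [Field F] {ι : Type*} [Fintype ι] (S : Finset ι) : Set (ι → F) :=
  {v | (∀ i, i ∈ S ↔ v i ≠ 0) ∧ v ⬝ᵥ v = 0}

theorem dotProduct_eq_restrict {S : Finset ι} {v : ι → F} (hv : ∀ i, i ∉ S → v i = 0)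
    (w : ι → F) : w ⬝ᵥ v = S.restrict w ⬝ᵥ S.restrict v := by
  simp only [dotProduct, Finset.restrict]
  rw [Finset.sum_coe_sort S fun i => w i * v i]
  symm
  apply Finset.sum_subset (Finset.subset_univ S)
  intro i _ hi
  rw [hv i hi, mul_zero]

theorem ncard_isoSupp (S : Finset ι) :
    (isoSupp F S).ncard = (isoSet (perp (⊥ : Submodule F (S → F)))).ncard := by
  rw [perp_bot]
  have h := ncard_restrict (F := F) S fun u => u ⬝ᵥ u = 0
  rw [isoSet]
  simp only [Submodule.mem_top, true_and]
  rw [← h]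
  congr 1
  ext v
  refine and_congr_right fun hv => ?_
  rw [dotProduct_eq_restrict hv]

variable [Fintype F]

theorem card_mul_ncard_isoSupp_le (S : Finset ι) (hS : S.Nonempty) :
    Fintype.card F * (isoSupp F S).ncard ≤ 2 * Fintype.card F ^ S.card := by
  classical
  obtain ⟨i, hi⟩ := hS
  rw [ncard_isoSupp, perp_bot]
  have h := card_mul_ncard_isoSet_le (F := F) (W := (⊤ : Submodule F (S → F)))
    ⟨Pi.single ⟨i, hi⟩ 1, Submodule.mem_top, by simp⟩
  rwa [finrank_top, Module.finrank_fintype_fun_eq_card, Fintype.card_coe] at h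

theorem card_mul_ncard_isoSupp (S : Finset ι) {m : ℕ} (hS : S.card = m + 1) (hm : 2 ≤ m) :
    Fintype.card F ^ (m + 1) ≤ Fintype.card F * (isoSupp F S).ncard + Fintype.card F ^ m ∧
      Fintype.card F * (isoSupp F S).ncard ≤
        Fintype.card F ^ (m + 1) + Fintype.card F ^ m := by
  classical
  have hne : S.Nonempty := Finset.card_pos.1 (by omega)
  obtain ⟨i, hi⟩ := hne
  rw [ncard_isoSupp]
  apply card_mul_ncard_isoSet_perp
  · exact ⟨Pi.single ⟨i, hi⟩ 1, by simp [perp_bot], by simp⟩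
  · rw [finrank_bot, Fintype.card_coe]
    omega
  · rw [finrank_bot]
    omega

theorem card_le_ncard_isoSupp_of_isSquare (S : Finset ι) (hS : S.card = 2)
    (h1 : IsSquare (-1 : F)) : Fintype.card F ≤ (isoSupp F S).ncard := by
  classical
  obtain ⟨a, b, hab, rfl⟩ := Finset.card_eq_two.1 hS
  obtain ⟨c, hc⟩ := h1
  rw [← Nat.card_eq_fintype_card, ← Set.ncard_univ]
  refine Set.ncard_le_ncard_of_injOn
    -- With `c ^ 2 = -1` the vector with entries `x` and `c * x` is singular.
    (fun x => (Pi.single a x + Pi.single b (c * x) : ι → F)) (fun x _ => ⟨?_, ?_⟩) ?_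
  · intro i hi
    rw [Finset.mem_insert, Finset.mem_singleton, not_or] at hi
    simp [hi.1, hi.2]
  · simp only [dotProduct_add, dotProduct_single, Pi.add_apply, Pi.single_eq_same,
      Pi.single_eq_of_ne hab, Pi.single_eq_of_ne hab.symm, add_zero, zero_add]
    linear_combination -x ^ 2 * hc
  · intro x _ y _ h
    have := congrFun h a
    simpa [Pi.single_eq_of_ne hab] using this

theorem le_card_mul_ncard_isoSupp (S : Finset ι) {m : ℕ} (hS : S.card = m + 1) (hm : 1 ≤ m)
    (h : 2 ≤ m ∨ IsSquare (-1 : F)) :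
    Fintype.card F ^ (m + 1) ≤ Fintype.card F * (isoSupp F S).ncard + Fintype.card F ^ m := by
  rcases le_or_gt 2 m with h2 | h2
  · exact (card_mul_ncard_isoSupp S hS h2).1
  · have hm1 : m = 1 := by omega
    subst hm1
    have := card_le_ncard_isoSupp_of_isSquare S hS (h.resolve_left (by omega))
    have := Nat.mul_le_mul_left (Fintype.card F) this
    rw [pow_succ, pow_one]
    omega

/-- Remove from the singular vectors supported in `S` those that vanish at some `a ∈ S`. Each of the
`m + 1` choices of `a` costs `2 * q ^ m`, and the count on `S` itself has error `q ^ m`, hence the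
constant `2 * m + 3`. -/
theorem le_card_mul_ncard_isoSuppEq (S : Finset ι) {m : ℕ} (hS : S.card = m + 1) (hm : 1 ≤ m)
    (h : 2 ≤ m ∨ IsSquare (-1 : F)) :
    Fintype.card F ^ (m + 1) ≤
      Fintype.card F * (isoSuppEq F S).ncard + (2 * m + 3) * Fintype.card F ^ m := by
  classical
  have hI := le_card_mul_ncard_isoSupp (F := F) S hS hm h
  have hsub : isoSupp F S ⊆ isoSuppEq F S ∪ ⋃ a ∈ S, isoSupp F (S.erase a) := by
    intro v hv
    by_cases hall : ∀ a ∈ S, v a ≠ 0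
    · refine Or.inl ⟨fun i => ⟨hall i, fun hi => ?_⟩, hv.2⟩
      by_contra hiS
      exact hi (hv.1 i hiS)
    · push Not at hall
      obtain ⟨a, ha, ha0⟩ := hall
      refine Or.inr (Set.mem_biUnion ha ⟨fun i hi => ?_, hv.2⟩)
      by_cases hia : i = a
      · rw [hia, ha0]
      · exact hv.1 i fun hiS => hi (Finset.mem_erase.2 ⟨hia, hiS⟩)
  have h1 : (isoSupp F S).ncard ≤
      (isoSuppEq F S).ncard + ∑ a ∈ S, (isoSupp F (S.erase a)).ncard :=
    (Set.ncard_le_ncard hsub).trans ((Set.ncard_union_le _ _).trans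
      (Nat.add_le_add_left (Finset.set_ncard_biUnion_le S _) _))
  have h2 : Fintype.card F * ∑ a ∈ S, (isoSupp F (S.erase a)).ncard ≤
      (m + 1) * (2 * Fintype.card F ^ m) := by
    rw [Finset.mul_sum, ← hS, ← smul_eq_mul S.card]
    refine Finset.sum_le_card_nsmul S _ _ fun a ha => ?_
    have hc : (S.erase a).card = m := by rw [Finset.card_erase_of_mem ha]; omega
    have := card_mul_ncard_isoSupp_le (F := F) (S.erase a) (Finset.card_pos.1 (by omega))
    rwa [hc] at this
  have h3 := Nat.mul_le_mul_left (Fintype.card F) h1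
  rw [mul_add] at h3
  have h4 : (2 * m + 3) * Fintype.card F ^ m =
      (m + 1) * (2 * Fintype.card F ^ m) + Fintype.card F ^ m := by ring
  omega

end Support

/-! ### Singular vectors of small weight -/

section LowWeight

open Classical in
/-- The nonzero singular vectors of Hamming weight at most `s`. -/
def lowWeight (F : Type*) [Field F] (ι : Type*) [Fintype ι] (s : ℕ) : Set (ι → F) :=
  {v | v ≠ 0 ∧ hammingNorm v ≤ s ∧ v ⬝ᵥ v = 0}

variable {F ι : Type*} [Field F] [Fintype ι]

theorem exists_supp_of_mem_lowWeight {s : ℕ} (hs : s ≤ Fintype.card ι) {v : ι → F}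
    (hv : v ∈ lowWeight F ι s) :
    ∃ S ∈ Finset.powersetCard s (Finset.univ : Finset ι), v ∈ isoSupp F S := by
  classical
  obtain ⟨S, hS, hSc⟩ := Finset.exists_superset_card_eq
    (s := Finset.univ.filter fun i => v i ≠ 0) (n := s)
    (by simpa [hammingNorm] using hv.2.1) hs
  refine ⟨S, Finset.mem_powersetCard.2 ⟨Finset.subset_univ _, hSc⟩, fun i hi => ?_, hv.2.2⟩
  by_contra h
  exact hi (hS (by simpa using h))

variable [Fintype F]

theorem ncard_lowWeight_le {s : ℕ} (hs : s ≤ Fintype.card ι) {c : ℕ}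
    (hc : ∀ S : Finset ι, S.card = s → Fintype.card F * (isoSupp F S).ncard ≤ c) :
    Fintype.card F * (lowWeight F ι s).ncard ≤ (Fintype.card ι).choose s * c := by
  classical
  have hsub : lowWeight F ι s ⊆
      ⋃ S ∈ Finset.powersetCard s (Finset.univ : Finset ι), isoSupp F S := by
    intro v hv
    obtain ⟨S, hS, h⟩ := exists_supp_of_mem_lowWeight hs hv
    exact Set.mem_biUnion hS h
  have h1 := (Set.ncard_le_ncard hsub).trans (Finset.set_ncard_biUnion_le _ _)
  refine (Nat.mul_le_mul_left _ h1).trans ?_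
  rw [Finset.mul_sum, ← Finset.card_univ (α := ι), ← Finset.card_powersetCard, ← smul_eq_mul]
  exact Finset.sum_le_card_nsmul _ _ _ fun S hS => hc S (Finset.mem_powersetCard.1 hS).2

theorem le_ncard_lowWeight {s : ℕ} (hs0 : 0 < s) {c b : ℕ}
    (hc : ∀ S : Finset ι, S.card = s → c ≤ Fintype.card F * (isoSuppEq F S).ncard + b) :
    (Fintype.card ι).choose s * c ≤
      Fintype.card F * (lowWeight F ι s).ncard + (Fintype.card ι).choose s * b := by
  classical
  have hsub : (⋃ S ∈ Finset.powersetCard s (Finset.univ : Finset ι), isoSuppEq F S) ⊆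
      lowWeight F ι s := by
    intro v hv
    simp only [Set.mem_iUnion, exists_prop] at hv
    obtain ⟨S, hS, hv1, hv2⟩ := hv
    have hSc := (Finset.mem_powersetCard.1 hS).2
    have hSv : Finset.univ.filter (fun i => v i ≠ 0) = S := by
      ext i
      simp [hv1 i]
    refine ⟨?_, ?_, hv2⟩
    · rintro rfl
      rw [← hSc, ← hSv] at hs0
      simp at hs0
    · rw [hammingNorm, hSv, hSc]
  have h1 := Set.ncard_le_ncard hsub
  have h2 : (⋃ S ∈ Finset.powersetCard s (Finset.univ : Finset ι), isoSuppEq F S).ncard =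
      ∑ S ∈ Finset.powersetCard s (Finset.univ : Finset ι), (isoSuppEq F S).ncard := by
    have h := Set.Finite.ncard_biUnion
      (Finset.finite_toSet (Finset.powersetCard s (Finset.univ : Finset ι)))
      (s := isoSuppEq F) (fun _ _ => Set.toFinite _) (fun S _ T _ hST => by
        rw [Function.onFun, Set.disjoint_left]
        intro v hv hw
        exact hST (Finset.ext fun i => (hv.1 i).trans (hw.1 i).symm))
    rwa [finsum_mem_coe_finset] at h
  rw [h2] at h1
  have h3 := Nat.mul_le_mul_left (Fintype.card F) h1
  rw [Finset.mul_sum] at h3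
  have h4 : ∑ S ∈ Finset.powersetCard s (Finset.univ : Finset ι), c ≤
      ∑ S ∈ Finset.powersetCard s (Finset.univ : Finset ι),
        (Fintype.card F * (isoSuppEq F S).ncard + b) :=
    Finset.sum_le_sum fun S hS => hc S (Finset.mem_powersetCard.1 hS).2
  rw [Finset.sum_add_distrib, Finset.sum_const, Finset.sum_const, Finset.card_powersetCard,
    Finset.card_univ, smul_eq_mul, smul_eq_mul] at h4
  omega

end LowWeight

/-! ### Orthogonal pairs of singular vectors of small weight -/

section Pairs

variable {F ι : Type*} [Field F] [Fintype ι] [Fintype F]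

/-- The quadratic bound applies on the hyperplane `u^⊥` unless it is totally singular. That is
excluded by dimension in odd characteristic, and in characteristic 2 it would force `1 ∈ ⟨u⟩`, so
`u` would be constant. -/
theorem card_mul_ncard_orthogonal_le {κ : Type*} [Fintype κ] {u : κ → F}
    (hu : ∀ c : F, u ≠ fun _ => c) {m : ℕ} (hκ : Fintype.card κ = m + 1) (hm : 2 ≤ m) :
    Fintype.card F * {x : κ → F | u ⬝ᵥ x = 0 ∧ x ⬝ᵥ x = 0}.ncard ≤ 2 * Fintype.card F ^ m := by
  have h0 := finrank_perp_add (Submodule.span F {u})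
  rw [finrank_span_singleton (hu 0)] at h0
  have hW : ∃ w ∈ perp (Submodule.span F {u}), w ⬝ᵥ w ≠ 0 := by
    by_cases h2 : (2 : F) = 0
    · by_contra! hc
      rw [forall_dotProduct_self_perp_iff h2, Submodule.mem_span_singleton] at hc
      obtain ⟨a, ha⟩ := hc
      refine hu a⁻¹ (funext fun i => ?_)
      have := congrFun ha i
      rw [Pi.smul_apply, Pi.one_apply, smul_eq_mul] at this
      exact eq_inv_of_mul_eq_one_right this
    · exact exists_dotProduct_self_ne_zero h2 (by omega)
  have h := card_mul_ncard_isoSet_le hW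
  rw [show Module.finrank F (perp (Submodule.span F {u})) = m by omega] at h
  simpa only [isoSet, mem_perp_span_singleton] using h

theorem card_mul_ncard_isoSupp_orthogonal_le {S : Finset ι} {v : ι → F}
    (hv : ∀ c : F, S.restrict v ≠ fun _ => c) {m : ℕ} (hS : S.card = m + 1) (hm : 2 ≤ m) :
    Fintype.card F * {w | w ∈ isoSupp F S ∧ v ⬝ᵥ w = 0}.ncard ≤ 2 * Fintype.card F ^ m := by
  have h := card_mul_ncard_orthogonal_le hv ((Fintype.card_coe S).trans hS) hm
  rw [← ncard_restrict] at h
  convert h using 3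
  ext w
  simp only [isoSupp, Set.mem_ofPred_eq]
  constructor
  · rintro ⟨⟨h1, h2⟩, h3⟩
    rw [dotProduct_eq_restrict h1] at h2 h3
    exact ⟨h1, h3, h2⟩
  · rintro ⟨h1, h3, h2⟩
    rw [← dotProduct_eq_restrict h1] at h2 h3
    exact ⟨⟨h1, h2⟩, h3⟩

/-- Few singular vectors supported in `S` are constant on `T`. -/
theorem card_mul_ncard_isoSupp_const_le {S T : Finset ι} {m : ℕ} (hS : S.card = m + 1)
    (hT : T.card = m + 1) (hm : 2 ≤ m) (hST : ¬ Disjoint S T) :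
    Fintype.card F * {v | v ∈ isoSupp F S ∧ ∃ c : F, T.restrict v = fun _ => c}.ncard ≤
      2 * Fintype.card F ^ m := by
  classical
  have hq : 0 < Fintype.card F := Fintype.card_pos
  have hqm : Fintype.card F ^ 2 ≤ Fintype.card F ^ m := Nat.pow_le_pow_right hq hm
  by_cases hEq : S = T
  · subst hEq
    have hsub : {v | v ∈ isoSupp F S ∧ ∃ c : F, S.restrict v = fun _ => c} ⊆
        (fun c i => if i ∈ S then c else 0 : F → ι → F) '' Set.univ := by
      rintro v ⟨⟨hv, -⟩, c, hc⟩
      refine ⟨c, Set.mem_univ _, funext fun i => ?_⟩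
      by_cases hi : i ∈ S
      · simpa [hi] using (congrFun hc ⟨i, hi⟩).symm
      · simp [hi, hv i hi]
    have h1 := (Set.ncard_le_ncard hsub).trans (Set.ncard_image_le)
    rw [Set.ncard_univ, Nat.card_eq_fintype_card] at h1
    have h2 := Nat.mul_le_mul_left (Fintype.card F) h1
    rw [← pow_two] at h2
    omega
  -- At a point of `T` outside `S` the vector vanishes, so its constant value on `T` is zero and its
  -- support lies in `S \ T`, which is smaller than `S`.
  · obtain ⟨b, hbT, hbS⟩ : ∃ b ∈ T, b ∉ S := by
      by_contra! hc
      exact hEq (Finset.eq_of_subset_of_card_le hc (by omega)).symm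
    have hsub : {v | v ∈ isoSupp F S ∧ ∃ c : F, T.restrict v = fun _ => c} ⊆
        isoSupp F (S \ T) := by
      rintro v ⟨⟨hv, hv2⟩, c, hc⟩
      refine ⟨fun i hi => ?_, hv2⟩
      by_cases hiS : i ∈ S
      · have hiT : i ∈ T := by
          by_contra h
          exact hi (Finset.mem_sdiff.2 ⟨hiS, h⟩)
        have h1 := congrFun hc ⟨i, hiT⟩
        have h2 := congrFun hc ⟨b, hbT⟩
        simp only [Finset.restrict] at h1 h2
        rw [h1, ← h2, hv b hbS]
      · exact hv i hiS
    have h1 := Nat.mul_le_mul_left (Fintype.card F) (Set.ncard_le_ncard hsub)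
    refine h1.trans ?_
    by_cases hne : (S \ T).Nonempty
    · refine (card_mul_ncard_isoSupp_le _ hne).trans ?_
      have hlt : (S \ T).card < S.card := by
        apply Finset.card_lt_card
        rw [Finset.ssubset_iff_subset_ne]
        refine ⟨Finset.sdiff_subset, fun h => hST ?_⟩
        rw [← h]
        exact Finset.sdiff_disjoint
      exact Nat.mul_le_mul_left 2 (Nat.pow_le_pow_right hq (by omega))
    · rw [Finset.not_nonempty_iff_eq_empty] at hne
      rw [hne]
      have h0 : isoSupp F (∅ : Finset ι) ⊆ {0} := by
        rintro v ⟨hv, -⟩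
        exact funext fun i => hv i (Finset.notMem_empty i)
      have h2 := Set.ncard_le_ncard h0
      rw [Set.ncard_singleton] at h2
      have h3 := Nat.mul_le_mul_left (Fintype.card F) h2
      have h4 : Fintype.card F ≤ Fintype.card F ^ m := Nat.le_self_pow (by omega) _
      omega

theorem ncard_pairs_eq_sum {α β : Type*} [Fintype α] [Finite β] (r : α → β → Prop) :
    {p : α × β | r p.1 p.2}.ncard = ∑ a, {b | r a b}.ncard := by
  rw [← Nat.card_coe_set_eq]
  refine (Nat.card_congr (Equiv.subtypeProdEquivSigmaSubtype r)).trans ?_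
  rw [Nat.card_sigma]
  rfl

/-- If `v` is not constant on `T`, orthogonality to `v` saves a factor `q` among the singular `w` on
`T`. If it is constant there, nothing is saved for `w`, but such `v` are rarer by a factor `q`. Each
case contributes `4 * q ^ (2 * m + 1)`. -/
theorem sq_mul_ncard_isoSupp_pairs_le {S T : Finset ι} {m : ℕ} (hS : S.card = m + 1)
    (hT : T.card = m + 1) (hm : 2 ≤ m) (hST : ¬ Disjoint S T) :
    Fintype.card F ^ 2 *
        {p : (ι → F) × (ι → F) | p.1 ∈ isoSupp F S ∧ p.2 ∈ isoSupp F T ∧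
          p.1 ⬝ᵥ p.2 = 0}.ncard ≤ 8 * Fintype.card F ^ (2 * m + 1) := by
  classical
  set q := Fintype.card F with hq
  rw [ncard_pairs_eq_sum fun v w : ι → F => v ∈ isoSupp F S ∧ w ∈ isoSupp F T ∧ v ⬝ᵥ w = 0]
  have hSne : S.Nonempty := Finset.card_pos.1 (by omega)
  have hTne : T.Nonempty := Finset.card_pos.1 (by omega)
  have hterm : ∀ v : ι → F, q *
      {w | v ∈ isoSupp F S ∧ w ∈ isoSupp F T ∧ v ⬝ᵥ w = 0}.ncard ≤
      (if v ∈ isoSupp F S then 2 * q ^ m else 0) +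
      (if v ∈ isoSupp F S ∧ ∃ c : F, T.restrict v = fun _ => c then 2 * q ^ (m + 1) else 0) := by
    intro v
    by_cases hv : v ∈ isoSupp F S
    · simp only [hv, true_and, if_true]
      split_ifs with hc
      · refine le_trans (Nat.mul_le_mul_left _ (Set.ncard_le_ncard fun w hw => hw.1))
          ((card_mul_ncard_isoSupp_le (F := F) T hTne).trans ?_)
        rw [hT]
        exact Nat.le_add_left _ _
      · push Not at hc
        exact card_mul_ncard_isoSupp_orthogonal_le hc hT hm
    · simp [hv]
  have h1 := Finset.sum_le_sum fun v (_ : v ∈ Finset.univ) => hterm v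
  rw [← Finset.mul_sum, Finset.sum_add_distrib, sum_ite_const_eq_ncard_mul,
    sum_ite_const_eq_ncard_mul] at h1
  have h2 := card_mul_ncard_isoSupp_le (F := F) S hSne
  have h3 := card_mul_ncard_isoSupp_const_le (F := F) hS hT hm hST
  rw [hS] at h2
  rw [← hq] at h2 h3
  have h4 := Nat.mul_le_mul_left q h1
  rw [pow_two, mul_assoc]
  refine h4.trans ?_
  change q * ((isoSupp F S).ncard * _ + _) ≤ _
  calc _ = (q * (isoSupp F S).ncard) * (2 * q ^ m) +
        (q * {v | v ∈ isoSupp F S ∧ ∃ c : F, T.restrict v = fun _ => c}.ncard) *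
          (2 * q ^ (m + 1)) := by ring
    _ ≤ (2 * q ^ (m + 1)) * (2 * q ^ m) + (2 * q ^ m) * (2 * q ^ (m + 1)) := by gcongr
    _ = _ := by ring

theorem sq_mul_ncard_lowWeight_pairs_le {m : ℕ} (hm : 2 ≤ m)
    (hn : m + 1 ≤ Fintype.card ι) (hn2 : Fintype.card ι < 2 * (m + 1)) :
    Fintype.card F ^ 2 *
        {p : (ι → F) × (ι → F) | p.1 ∈ lowWeight F ι (m + 1) ∧ p.2 ∈ lowWeight F ι (m + 1) ∧
          p.1 ⬝ᵥ p.2 = 0}.ncard ≤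
      ((Fintype.card ι).choose (m + 1)) ^ 2 * (8 * Fintype.card F ^ (2 * m + 1)) := by
  classical
  let Z := Finset.powersetCard (m + 1) (Finset.univ : Finset ι)
  have hsub : {p : (ι → F) × (ι → F) | p.1 ∈ lowWeight F ι (m + 1) ∧
      p.2 ∈ lowWeight F ι (m + 1) ∧ p.1 ⬝ᵥ p.2 = 0} ⊆
      ⋃ P ∈ Z ×ˢ Z, {p : (ι → F) × (ι → F) | p.1 ∈ isoSupp F P.1 ∧ p.2 ∈ isoSupp F P.2 ∧
          p.1 ⬝ᵥ p.2 = 0} := by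
    rintro ⟨v, w⟩ ⟨hv, hw, hvw⟩
    obtain ⟨S, hS, hvS⟩ := exists_supp_of_mem_lowWeight hn hv
    obtain ⟨T, hT, hwT⟩ := exists_supp_of_mem_lowWeight hn hw
    exact Set.mem_biUnion (x := (S, T)) (Finset.mem_product.2 ⟨hS, hT⟩) ⟨hvS, hwT, hvw⟩
  have h1 := (Set.ncard_le_ncard hsub).trans (Finset.set_ncard_biUnion_le _ _)
  refine (Nat.mul_le_mul_left _ h1).trans ?_
  have hcard : (Z ×ˢ Z).card = ((Fintype.card ι).choose (m + 1)) ^ 2 := by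
    rw [Finset.card_product, Finset.card_powersetCard, Finset.card_univ, pow_two]
  rw [Finset.mul_sum, ← hcard, ← smul_eq_mul (Z ×ˢ Z).card]
  refine Finset.sum_le_card_nsmul _ _ _ fun P hP => ?_
  have hP1 := (Finset.mem_powersetCard.1 (Finset.mem_product.1 hP).1).2
  have hP2 := (Finset.mem_powersetCard.1 (Finset.mem_product.1 hP).2).2
  -- Two disjoint supports of size `m + 1` do not fit into fewer than `2 * (m + 1)` coordinates.
  refine sq_mul_ncard_isoSupp_pairs_le hP1 hP2 hm fun hd => ?_
  have h3 := Finset.card_union_of_disjoint hd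
  have h4 := Finset.card_le_univ (P.1 ∪ P.2)
  omega

end Pairs

/-! ### First and second moment inequalities -/

section Moments

variable {F V : Type*} [Field F] [Fintype F] [AddCommGroup V] [Module F V] [Finite V]

theorem ncard_span_sdiff_zero {v : V} (hv : v ≠ 0) :
    ((Submodule.span F {v} : Set V) \ {0}).ncard = Fintype.card F - 1 := by
  rw [Set.ncard_sdiff (by simp), Set.ncard_singleton, ncard_submodule, finrank_span_singleton hv,
    pow_one]

theorem span_sdiff_zero_subset {F V : Type*} [Field F] [AddCommGroup V] [Module F V]
    {L : Set V} (hL : ∀ v ∈ L, ∀ c : F, c ≠ 0 → c • v ∈ L) {C : Submodule F V} {v : V} (hv : v ∈ L) (hvC : v ∈ C) :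
    (Submodule.span F {v} : Set V) \ {0} ⊆ {x | x ∈ L ∧ x ∈ C} := by
  rintro x ⟨hx, hx0⟩
  obtain ⟨c, rfl⟩ := Submodule.mem_span_singleton.1 hx
  refine ⟨hL v hv c ?_, C.smul_mem c hvC⟩
  rintro rfl
  exact hx0 (zero_smul F v)

/-- First moment bound for the number of spaces that meet `L`. -/
theorem ncard_meet_mul_le {L : Set V} (hL0 : (0 : V) ∉ L)
    (hL : ∀ v ∈ L, ∀ c : F, c ≠ 0 → c • v ∈ L) {𝒞 : Set (Submodule F V)} {β : ℝ}
    (hβ : ∀ v ∈ L, ({C | C ∈ 𝒞 ∧ v ∈ C}.ncard : ℝ) ≤ β) :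
    ({C | C ∈ 𝒞 ∧ ∃ v ∈ L, v ∈ C}.ncard : ℝ) * ((Fintype.card F : ℝ) - 1) ≤ L.ncard * β := by
  classical
  have := Fintype.ofFinite V
  have := Fintype.ofFinite (Submodule F V)
  have h := sum_ncard_comm fun (v : V) (C : Submodule F V) => v ∈ L ∧ C ∈ 𝒞 ∧ v ∈ C
  have h1 : {C | C ∈ 𝒞 ∧ ∃ v ∈ L, v ∈ C}.ncard * (Fintype.card F - 1) ≤
      ∑ C : Submodule F V, {v | v ∈ L ∧ C ∈ 𝒞 ∧ v ∈ C}.ncard := by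
    rw [← sum_ite_const_eq_ncard_mul]
    refine Finset.sum_le_sum fun C _ => ?_
    split_ifs with hC
    · obtain ⟨hC𝒞, v, hv, hvC⟩ := hC
      -- A space that meets `L` contains all `q - 1` nonzero multiples of a common vector, and these
      -- lie in `L`.
      rw [← ncard_span_sdiff_zero (F := F) (fun h => hL0 (h ▸ hv) : v ≠ 0)]
      refine Set.ncard_le_ncard fun x hx => ?_
      have := span_sdiff_zero_subset hL hv hvC hx
      exact ⟨this.1, hC𝒞, this.2⟩
    · exact Nat.zero_le _
  rw [← h] at h1
  have h2 : (∑ v : V, ({C | v ∈ L ∧ C ∈ 𝒞 ∧ v ∈ C}.ncard : ℝ)) ≤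
      ∑ v : V, (if v ∈ L then β else 0) := by
    refine Finset.sum_le_sum fun v _ => ?_
    split_ifs with hv
    · simpa [hv] using hβ v hv
    · simp [hv]
  rw [← Finset.sum_filter, Finset.sum_const, nsmul_eq_mul] at h2
  have h3 : (Finset.univ.filter fun v => v ∈ L).card = L.ncard := by
    rw [Set.ncard_eq_toFinset_card', Set.filter_mem_univ_eq_toFinset]
  rw [h3] at h2
  refine le_trans ?_ h2
  have h4 : (1 : ℕ) ≤ Fintype.card F := Fintype.card_pos
  have h5 : ((Fintype.card F - 1 : ℕ) : ℝ) = (Fintype.card F : ℝ) - 1 := by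
    rw [Nat.cast_sub h4, Nat.cast_one]
  rw [← h5]
  exact_mod_cast h1

/-- If `x` vectors of `L` lie in `C`, then `x * (x - (q - 1))` counts the non-proportional ordered
pairs, and the inequality rearranges to `(x - (q - 1)) ^ 2 ≥ 0`. Summed over `C`, it bounds the
number of spaces meeting `L` from below. -/
theorem mul_ncard_le_add_ncard_pairs {L : Set V} (hL0 : (0 : V) ∉ L)
    (hL : ∀ v ∈ L, ∀ c : F, c ≠ 0 → c • v ∈ L) (C : Submodule F V) {v₀ : V} (hv₀ : v₀ ∈ L)
    (hv₀C : v₀ ∈ C) :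
    (Fintype.card F - 1) * {v | v ∈ L ∧ v ∈ C}.ncard ≤ (Fintype.card F - 1) ^ 2 +
      {p : V × V | (p.1 ∈ L ∧ p.1 ∈ C) ∧ p.2 ∈ L ∧ p.2 ∈ C ∧
        p.2 ∉ Submodule.span F {p.1}}.ncard := by
  classical
  have := Fintype.ofFinite V
  set X := {v | v ∈ L ∧ v ∈ C} with hX
  have h1 : Fintype.card F - 1 ≤ X.ncard := by
    rw [← ncard_span_sdiff_zero (F := F) (fun h => hL0 (h ▸ hv₀) : v₀ ≠ 0)]
    exact Set.ncard_le_ncard (span_sdiff_zero_subset hL hv₀ hv₀C)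
  have h2 : X.ncard * (X.ncard - (Fintype.card F - 1)) =
      {p : V × V | (p.1 ∈ L ∧ p.1 ∈ C) ∧ p.2 ∈ L ∧ p.2 ∈ C ∧
        p.2 ∉ Submodule.span F {p.1}}.ncard := by
    rw [ncard_pairs_eq_sum fun v w => (v ∈ L ∧ v ∈ C) ∧ w ∈ L ∧ w ∈ C ∧
      w ∉ Submodule.span F {v}, hX, ← sum_ite_const_eq_ncard_mul]
    refine Finset.sum_congr rfl fun v _ => ?_
    split_ifs with hv
    · have hsub := span_sdiff_zero_subset hL hv.1 hv.2
      rw [← ncard_span_sdiff_zero (F := F) (fun h => hL0 (h ▸ hv.1) : v ≠ 0),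
        ← Set.ncard_sdiff hsub]
      congr 1
      ext w
      simp only [Set.mem_sdiff, Set.mem_ofPred_eq, SetLike.mem_coe, Set.mem_singleton_iff]
      constructor
      · rintro ⟨⟨hw1, hw2⟩, hw3⟩
        exact ⟨hv, hw1, hw2, fun hs => hw3 ⟨hs, fun h0 => hL0 (h0 ▸ hw1)⟩⟩
      · rintro ⟨-, hw1, hw2, hw3⟩
        exact ⟨⟨hw1, hw2⟩, fun hs => hw3 hs.1⟩
    · symm
      rw [Set.ncard_eq_zero (Set.toFinite _), Set.eq_empty_iff_forall_notMem]
      exact fun w hw => hv hw.1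
  rw [← h2]
  obtain ⟨y, hy⟩ := Nat.exists_eq_add_of_le h1
  rw [hy, Nat.add_sub_cancel_left]
  nlinarith [Nat.zero_le (y * y)]

/-- Second moment bound for the number of spaces that meet `L`. -/
theorem le_ncard_meet_mul {L : Set V} (hL0 : (0 : V) ∉ L)
    (hL : ∀ v ∈ L, ∀ c : F, c ≠ 0 → c • v ∈ L) {𝒞 : Set (Submodule F V)} {α γ : ℝ}
    (hα : ∀ v ∈ L, α ≤ ({C | C ∈ 𝒞 ∧ v ∈ C}.ncard : ℝ)) {P : Set (V × V)} (hγ0 : 0 ≤ γ)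
    (hγ : ∀ v ∈ L, ∀ w ∈ L, w ∉ Submodule.span F {v} →
      ({C | C ∈ 𝒞 ∧ v ∈ C ∧ w ∈ C}.ncard : ℝ) ≤ γ)
    (hP : ∀ v ∈ L, ∀ w ∈ L, ∀ C ∈ 𝒞, v ∈ C → w ∈ C → (v, w) ∈ P) :
    ((Fintype.card F : ℝ) - 1) * (L.ncard * α) ≤
      ((Fintype.card F : ℝ) - 1) ^ 2 * ({C | C ∈ 𝒞 ∧ ∃ v ∈ L, v ∈ C}.ncard : ℝ) +
        P.ncard * γ := by
  classical
  have := Fintype.ofFinite V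
  have := Fintype.ofFinite (Submodule F V)
  have h1 := sum_ncard_comm fun (v : V) (C : Submodule F V) => v ∈ L ∧ C ∈ 𝒞 ∧ v ∈ C
  have h2 := sum_ncard_comm fun (p : V × V) (C : Submodule F V) => C ∈ 𝒞 ∧
    (p.1 ∈ L ∧ p.1 ∈ C) ∧ p.2 ∈ L ∧ p.2 ∈ C ∧ p.2 ∉ Submodule.span F {p.1}
  have h3 : (Fintype.card F - 1) * ∑ C : Submodule F V, {v | v ∈ L ∧ C ∈ 𝒞 ∧ v ∈ C}.ncard ≤
      {C | C ∈ 𝒞 ∧ ∃ v ∈ L, v ∈ C}.ncard * (Fintype.card F - 1) ^ 2 +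
      ∑ C : Submodule F V, {p : V × V | C ∈ 𝒞 ∧ (p.1 ∈ L ∧ p.1 ∈ C) ∧ p.2 ∈ L ∧ p.2 ∈ C ∧
        p.2 ∉ Submodule.span F {p.1}}.ncard := by
    rw [← sum_ite_const_eq_ncard_mul, ← Finset.sum_add_distrib, Finset.mul_sum]
    refine Finset.sum_le_sum fun C _ => ?_
    split_ifs with hC
    · obtain ⟨hC𝒞, v, hv, hvC⟩ := hC
      simpa only [hC𝒞, true_and] using mul_ncard_le_add_ncard_pairs hL0 hL C hv hvC
    · have h0 : {v | v ∈ L ∧ C ∈ 𝒞 ∧ v ∈ C} = ∅ := by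
        rw [Set.eq_empty_iff_forall_notMem]
        exact fun v hv => hC ⟨hv.2.1, v, hv.1, hv.2.2⟩
      rw [h0, Set.ncard_empty, mul_zero]
      exact Nat.zero_le _
  rw [← h1, ← h2] at h3
  have h4 : (L.ncard : ℝ) * α ≤ ∑ v : V, ({C | v ∈ L ∧ C ∈ 𝒞 ∧ v ∈ C}.ncard : ℝ) := by
    have : ∑ v : V, (if v ∈ L then α else 0) = L.ncard * α := by
      rw [← Finset.sum_filter, Finset.sum_const, nsmul_eq_mul, Set.ncard_eq_toFinset_card',
        Set.filter_mem_univ_eq_toFinset]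
    rw [← this]
    refine Finset.sum_le_sum fun v _ => ?_
    split_ifs with hv
    · simpa [hv] using hα v hv
    · simp [hv]
  have h5 : ∑ p : V × V, ({C | C ∈ 𝒞 ∧ (p.1 ∈ L ∧ p.1 ∈ C) ∧ p.2 ∈ L ∧ p.2 ∈ C ∧
        p.2 ∉ Submodule.span F {p.1}}.ncard : ℝ) ≤ P.ncard * γ := by
    have : ∑ p : V × V, (if p ∈ P then γ else 0) = P.ncard * γ := by
      rw [← Finset.sum_filter, Finset.sum_const, nsmul_eq_mul, Set.ncard_eq_toFinset_card',
        Set.filter_mem_univ_eq_toFinset]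
    rw [← this]
    refine Finset.sum_le_sum fun p _ => ?_
    by_cases hp : p.1 ∈ L ∧ p.2 ∈ L ∧ p.2 ∉ Submodule.span F {p.1} ∧
        ∃ C ∈ 𝒞, p.1 ∈ C ∧ p.2 ∈ C
    · obtain ⟨hv, hw, hvw, C, hC, hvC, hwC⟩ := hp
      rw [if_pos (hP _ hv _ hw C hC hvC hwC)]
      simpa [hv, hw, hvw] using hγ _ hv _ hw hvw
    · have h0 : {C | C ∈ 𝒞 ∧ (p.1 ∈ L ∧ p.1 ∈ C) ∧ p.2 ∈ L ∧ p.2 ∈ C ∧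
          p.2 ∉ Submodule.span F {p.1}} = ∅ := by
        rw [Set.eq_empty_iff_forall_notMem]
        rintro C ⟨h1, ⟨h2, h3⟩, h4, h5, h6⟩
        exact hp ⟨h2, h4, h6, C, h1, h3, h5⟩
      rw [h0, Set.ncard_empty, Nat.cast_zero]
      split_ifs
      · exact hγ0
      · exact le_rfl
  have h6 : (1 : ℕ) ≤ Fintype.card F := Fintype.card_pos
  have h7 : ((Fintype.card F - 1 : ℕ) : ℝ) = (Fintype.card F : ℝ) - 1 := by
    rw [Nat.cast_sub h6, Nat.cast_one]
  have h8 : ((Fintype.card F - 1 : ℕ) : ℝ) *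
      ∑ v : V, ({C | v ∈ L ∧ C ∈ 𝒞 ∧ v ∈ C}.ncard : ℝ) ≤
      ({C | C ∈ 𝒞 ∧ ∃ v ∈ L, v ∈ C}.ncard : ℝ) * ((Fintype.card F - 1 : ℕ) : ℝ) ^ 2 +
      ∑ p : V × V, ({C | C ∈ 𝒞 ∧ (p.1 ∈ L ∧ p.1 ∈ C) ∧ p.2 ∈ L ∧ p.2 ∈ C ∧
        p.2 ∉ Submodule.span F {p.1}}.ncard : ℝ) := by exact_mod_cast h3
  rw [← h7]
  calc _ ≤ ((Fintype.card F - 1 : ℕ) : ℝ) *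
      ∑ v : V, ({C | v ∈ L ∧ C ∈ 𝒞 ∧ v ∈ C}.ncard : ℝ) := by gcongr
    _ ≤ _ := h8.trans (by rw [mul_comm]; gcongr)

end Moments

/-! ### Uniform incidence of low-weight vectors with codes -/

section RegularCodes

/-- The relative error in the count of extensions. -/
def errorFactor (q : ℝ) (k : ℕ) : ℝ := ((1 + 1 / q) / (1 - 2 / q)) ^ k

variable {F ι : Type*} [Field F] [Fintype ι]

theorem lowWeight_mono {s t : ℕ} (h : s ≤ t) : lowWeight F ι s ⊆ lowWeight F ι t :=
  fun _ hv => ⟨hv.1, hv.2.1.trans h, hv.2.2⟩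

theorem exists_eq_zero_of_mem_lowWeight {s : ℕ} (hs : s < Fintype.card ι) {v : ι → F}
    (hv : v ∈ lowWeight F ι s) : ∃ i, v i = 0 := by
  classical
  by_contra! hc
  have h := hv.2.1
  rw [hammingNorm, Finset.filter_true_of_mem fun i _ => hc i, Finset.card_univ] at h
  omega

/-- Two supports of size at most `s < n / 2` cannot cover all coordinates. This makes independent
`v`, `w` independent modulo `1`. -/
theorem exists_eq_zero_eq_zero_of_mem_lowWeight {s : ℕ} (hs : 2 * s < Fintype.card ι)
    {v w : ι → F} (hv : v ∈ lowWeight F ι s) (hw : w ∈ lowWeight F ι s) :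
    ∃ i, v i = 0 ∧ w i = 0 := by
  classical
  by_contra! hc
  have h1 := hv.2.1
  have h2 := hw.2.1
  have h3 : (Finset.univ : Finset ι) ⊆
      (Finset.univ.filter fun i => v i ≠ 0) ∪ (Finset.univ.filter fun i => w i ≠ 0) := by
    intro i _
    by_cases hi : v i = 0
    · simp [hc i hi]
    · simp [hi]
  have h4 := (Finset.card_le_card h3).trans (Finset.card_union_le _ _)
  rw [Finset.card_univ] at h4
  unfold hammingNorm at h1 h2
  have h5 : (Finset.univ.filter fun i => v i ≠ 0).card ≤ s := by convert h1
  have h6 : (Finset.univ.filter fun i => w i ≠ 0).card ≤ s := by convert h2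
  omega

theorem notMem_span_one_of_mem_lowWeight {s : ℕ} (hs : s < Fintype.card ι) {v : ι → F}
    (hv : v ∈ lowWeight F ι s) : v ∉ Submodule.span F {(1 : ι → F)} := by
  intro h
  obtain ⟨c, rfl⟩ := Submodule.mem_span_singleton.1 h
  obtain ⟨i, hi⟩ := exists_eq_zero_of_mem_lowWeight hs hv
  rw [Pi.smul_apply, Pi.one_apply, smul_eq_mul, mul_one] at hi
  exact hv.1 (by rw [hi, zero_smul])

/-- Such a code equals its orthogonal, which is therefore totally singular. -/
theorem one_mem_of_selfPerp_of_two_mul_finrank (h2 : (2 : F) = 0) {C : Submodule F (ι → F)}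
    (hC : SelfPerp C) (hn : 2 * Module.finrank F C = Fintype.card ι) : 1 ∈ C := by
  have h := finrank_perp_add C
  have heq := Submodule.eq_of_le_of_finrank_le hC (by omega)
  rw [← forall_dotProduct_self_perp_iff h2, ← heq]
  exact fun x hx => hC.dotProduct_self hx

theorem selfPerp_span_one (h2 : (2 : F) = 0) (hn : Even (Fintype.card ι)) :
    SelfPerp (Submodule.span F {(1 : ι → F)}) := by
  have h := (selfPerp_sup_span (F := F) (ι := ι) selfPerp_bot (v := 1)).2
  rw [bot_sup_eq] at h
  refine h ⟨by simp [perp_bot], ?_⟩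
  obtain ⟨m, hm⟩ := hn
  rw [one_dotProduct_one, hm]
  push_cast
  linear_combination (m : F) * h2

variable [Fintype F]

/-- The singular vectors of weight at most `s₁`, and the pairs of singular vectors of weight at
most `s₂`, are contained in about the expected number of members of `𝒞`. -/
structure RegularCodes (𝒞 : Set (Submodule F (ι → F))) (k s₁ s₂ : ℕ) : Prop where
  pos : 0 < 𝒞.ncard
  le_one : ∀ v ∈ lowWeight F ι s₁, ({C | C ∈ 𝒞 ∧ v ∈ C}.ncard : ℝ) *
    (Fintype.card F : ℝ) ^ (Fintype.card ι - 1) ≤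
      errorFactor (Fintype.card F) k * (Fintype.card F : ℝ) ^ k * 𝒞.ncard
  one_le : ∀ v ∈ lowWeight F ι s₁, (errorFactor (Fintype.card F) k)⁻¹ *
    ((Fintype.card F : ℝ) ^ k - (Fintype.card F : ℝ) ^ (k - 1)) * 𝒞.ncard ≤
      ({C | C ∈ 𝒞 ∧ v ∈ C}.ncard : ℝ) * (Fintype.card F : ℝ) ^ (Fintype.card ι - 1)
  le_two : ∀ v ∈ lowWeight F ι s₂, ∀ w ∈ lowWeight F ι s₂, w ∉ Submodule.span F {v} →
    ({C | C ∈ 𝒞 ∧ v ∈ C ∧ w ∈ C}.ncard : ℝ) *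
      ((Fintype.card F : ℝ) ^ (Fintype.card ι - 1) *
        (Fintype.card F : ℝ) ^ (Fintype.card ι - 2)) ≤
      errorFactor (Fintype.card F) k *
        ((Fintype.card F : ℝ) ^ k * (Fintype.card F : ℝ) ^ k) * 𝒞.ncard

theorem regularCodes_of_convexFamily {G : Submodule F (ι → F) → Prop} {k i₀ s₁ s₂ : ℕ}
    (hF : 2 < Fintype.card F) (hs : s₂ ≤ s₁) (hG : ConvexFamily G)
    {U₀ : Submodule F (ι → F)} (hU₀ : G U₀) (hi₀ : Module.finrank F U₀ = i₀) (hk : i₀ + 2 ≤ k)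
    {A : ℕ → ℝ} (hA : ∀ i, i₀ ≤ i → i < k → 0 < A i)
    (hA0 : A i₀ = (Fintype.card F : ℝ) ^ (Fintype.card ι - 1))
    (hA1 : A (i₀ + 1) = (Fintype.card F : ℝ) ^ (Fintype.card ι - 2))
    (hstep : ∀ U : Submodule F (ι → F), G U → i₀ ≤ Module.finrank F U →
      Module.finrank F U < k →
      (1 - 2 / (Fintype.card F : ℝ)) * A (Module.finrank F U) ≤ (stepCount G U : ℝ) ∧
      (stepCount G U : ℝ) ≤ (1 + 1 / (Fintype.card F : ℝ)) * A (Module.finrank F U))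
    (h1 : ∀ v ∈ lowWeight F ι s₁, v ∉ U₀ ∧ G (U₀ ⊔ Submodule.span F {v}))
    (h2 : ∀ v ∈ lowWeight F ι s₂, ∀ w ∈ lowWeight F ι s₂, w ∉ Submodule.span F {v} →
      w ∉ U₀ ⊔ Submodule.span F {v}) :
    RegularCodes {C | Module.finrank F C = k ∧ G C ∧ U₀ ≤ C} k s₁ s₂ := by
  have hF2 : (2 : ℝ) < Fintype.card F := by exact_mod_cast hF
  have ha : (0 : ℝ) < 1 - 2 / (Fintype.card F : ℝ) := by
    rw [sub_pos, div_lt_one (by linarith)]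
    exact hF2
  have ha1 : 1 - 2 / (Fintype.card F : ℝ) ≤ 1 := sub_le_self _ (by positivity)
  have hb : 1 ≤ 1 + 1 / (Fintype.card F : ℝ) := le_add_of_nonneg_right (by positivity)
  obtain ⟨hpos, hle1, h1le, hle2⟩ :=
    extCount_regular hG hU₀ hi₀ hk ha ha1 hb hA hA0 hA1 hstep
  have hone : ∀ v, {C | C ∈ {C : Submodule F (ι → F) | Module.finrank F C = k ∧ G C ∧ U₀ ≤ C} ∧ v ∈ C}.ncard =
      extCount G k (U₀ ⊔ Submodule.span F {v}) := by
    intro v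
    unfold extCount
    congr 1
    ext C
    simp only [Set.mem_ofPred_eq, sup_le_iff, Submodule.span_singleton_le_iff_mem]
    tauto
  have htwo : ∀ v w,
      {C | C ∈ {C : Submodule F (ι → F) | Module.finrank F C = k ∧ G C ∧ U₀ ≤ C} ∧ v ∈ C ∧ w ∈ C}.ncard =
      extCount G k (U₀ ⊔ Submodule.span F {v} ⊔ Submodule.span F {w}) := by
    intro v w
    unfold extCount
    congr 1
    ext C
    simp only [Set.mem_ofPred_eq, sup_le_iff, Submodule.span_singleton_le_iff_mem]
    tauto
  refine ⟨hpos, fun v hv => ?_, fun v hv => ?_, fun v hv w hw hvw => ?_⟩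
  · rw [hone]
    exact hle1 _ le_sup_left (by rw [finrank_sup_span (h1 v hv).1, hi₀])
  · rw [hone]
    refine le_trans ?_ (h1le _ (h1 v hv).2 (by rw [finrank_sup_span (h1 v hv).1, hi₀]))
    rw [errorFactor, ← inv_pow, inv_div]
    -- Weakening `q ^ i₀` to `q ^ (k - 1)` gives one bound for both starting dimensions 0 and 1.
    have h3 : (Fintype.card F : ℝ) ^ i₀ ≤ (Fintype.card F : ℝ) ^ (k - 1) :=
      pow_le_pow_right₀ (by linarith) (by omega)
    unfold extCount
    gcongr
  · rw [htwo]
    refine hle2 _ (le_sup_left.trans le_sup_left) ?_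
    rw [finrank_sup_span (h2 v hv w hw hvw),
      finrank_sup_span (h1 v (lowWeight_mono hs hv)).1, hi₀]

theorem one_sub_mul_pow_le {q x c m : ℕ} (hq : 0 < q) (h : q ^ (m + 1) ≤ q * x + c * q ^ m) :
    (1 - (c : ℝ) / (q : ℝ)) * (q : ℝ) ^ m ≤ x := by
  have hq' : (0 : ℝ) < q := by exact_mod_cast hq
  have h' : (q : ℝ) ^ (m + 1) ≤ q * x + c * (q : ℝ) ^ m := by exact_mod_cast h
  refine le_of_mul_le_mul_left ?_ hq'
  have : (q : ℝ) * ((1 - (c : ℝ) / (q : ℝ)) * (q : ℝ) ^ m) =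
      (q : ℝ) ^ (m + 1) - c * (q : ℝ) ^ m := by
    field_simp
    ring
  linarith

theorem le_one_add_mul_pow {q x c m : ℕ} (hq : 0 < q) (h : q * x ≤ q ^ (m + 1) + c * q ^ m) :
    (x : ℝ) ≤ (1 + (c : ℝ) / (q : ℝ)) * (q : ℝ) ^ m := by
  have hq' : (0 : ℝ) < q := by exact_mod_cast hq
  have h' : q * x ≤ (q : ℝ) ^ (m + 1) + c * (q : ℝ) ^ m := by exact_mod_cast h
  refine le_of_mul_le_mul_left ?_ hq'
  have : (q : ℝ) * ((1 + (c : ℝ) / (q : ℝ)) * (q : ℝ) ^ m) =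
      (q : ℝ) ^ (m + 1) + c * (q : ℝ) ^ m := by
    field_simp
    ring
  linarith

theorem regularCodes_nonsingularPerp {k s : ℕ} (hF : 2 < Fintype.card F) (hk : 2 ≤ k)
    (hn : 2 * k < Fintype.card ι) (hs : s < Fintype.card ι) :
    RegularCodes {C : Submodule F (ι → F) | Module.finrank F C = k ∧ NonsingularPerp C}
      k s s := by
  classical
  have hq : 0 < Fintype.card F := by omega
  have hbot : NonsingularPerp (⊥ : Submodule F (ι → F)) := by
    obtain ⟨i⟩ := Fintype.card_pos_iff.1 (show 0 < Fintype.card ι by omega)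
    exact ⟨selfPerp_bot, Pi.single i 1, by simp [perp_bot], by simp⟩
  have h := regularCodes_of_convexFamily (G := NonsingularPerp) (k := k) (i₀ := 0) (s₁ := s)
    (s₂ := s) (U₀ := (⊥ : Submodule F (ι → F)))
    (A := fun i => (Fintype.card F : ℝ) ^ (Fintype.card ι - 1 - i)) hF le_rfl
    convexFamily_nonsingularPerp hbot (finrank_bot F _) (by omega) (fun i _ _ => by positivity) rfl rfl
    (fun U hU _ hUk => ?_) (fun v hv => ⟨?_, ?_⟩) (fun v _ w _ hvw => ?_)
  · simpa only [bot_le, and_true] using h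
  · have h := stepCount_nonsingularPerp hU
      (m := Fintype.card ι - 1 - Module.finrank F U) (by omega) (by omega)
    exact ⟨by exact_mod_cast one_sub_mul_pow_le hq h.1,
      by simpa using le_one_add_mul_pow (c := 1) hq (by simpa using h.2)⟩
  · rw [Submodule.mem_bot]
    exact hv.1
  · apply nonsingularPerp_sup_span hbot
    · exact ⟨by simp [perp_bot], hv.2.2⟩
    · rw [bot_sup_eq]
      exact notMem_span_one_of_mem_lowWeight hs hv
    · rw [finrank_bot]
      omega
  · rwa [bot_sup_eq]

theorem regularCodes_selfPerp_of_two_ne_zero (h2 : (2 : F) ≠ 0) {k s₁ s₂ : ℕ}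
    (hF : 2 < Fintype.card F) (hk : 3 ≤ k) (hn : 2 * k = Fintype.card ι) (hs : s₂ ≤ s₁)
    {C₀ : Submodule F (ι → F)} (hC₀ : SelfPerp C₀) (hC₀k : Module.finrank F C₀ = k) :
    RegularCodes {C : Submodule F (ι → F) | Module.finrank F C = k ∧ SelfPerp C} k s₁ s₂ := by
  have hq : 0 < Fintype.card F := by omega
  have h := regularCodes_of_convexFamily (G := SelfPerp) (k := k) (i₀ := 0) (s₁ := s₁)
    (s₂ := s₂) (U₀ := (⊥ : Submodule F (ι → F)))
    -- The last step into a self-dual code has twice the generic number of extensions. Since `3 ≤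
    -- k`, this does not touch the two values of `A` that must be generic.
    (A := fun i => if i + 1 = k then 2 * (Fintype.card F : ℝ) ^ k else
      (Fintype.card F : ℝ) ^ (Fintype.card ι - 1 - i)) hF hs
    convexFamily_selfPerp selfPerp_bot (finrank_bot F _) (by omega) (fun i _ _ => ?_)
    (if_neg (by omega)) (if_neg (by omega)) (fun U hU _ hUk => ?_) (fun v hv => ⟨?_, ?_⟩)
    (fun v _ w _ hvw => ?_)
  · simpa only [bot_le, and_true] using h
  · split_ifs <;> positivity
  · by_cases hUk1 : Module.finrank F U + 1 = k
    · have h := stepCount_selfPerp_of_hyperplane h2 hU rfl (by omega) hC₀ (by omega)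
      rw [hUk1] at h
      have hk' : Fintype.card F ^ k = Fintype.card F * Fintype.card F ^ Module.finrank F U := by
        rw [← hUk1, pow_succ']
      rw [if_pos hUk1]
      have hq' : (0 : ℝ) < Fintype.card F := by exact_mod_cast hq
      have h' : (stepCount SelfPerp U : ℝ) + 2 * (Fintype.card F : ℝ) ^ Module.finrank F U =
        2 * (Fintype.card F : ℝ) ^ k := by exact_mod_cast h
      have hk'' : (Fintype.card F : ℝ) ^ k =
          Fintype.card F * (Fintype.card F : ℝ) ^ Module.finrank F U := by exact_mod_cast hk'
      have h3 : 2 / (Fintype.card F : ℝ) * (2 * (Fintype.card F : ℝ) ^ k) =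
          4 * (Fintype.card F : ℝ) ^ Module.finrank F U := by
        rw [hk'']
        field_simp
        ring
      have h4 : 0 ≤ 1 / (Fintype.card F : ℝ) * (2 * (Fintype.card F : ℝ) ^ k) := by positivity
      have h5 : 0 ≤ (Fintype.card F : ℝ) ^ Module.finrank F U := by positivity
      rw [sub_mul, add_mul, h3]
      constructor <;> linarith
    · have h := stepCount_selfPerp h2 hU
        (m := Fintype.card ι - 1 - Module.finrank F U) (by omega) (by omega)
      rw [if_neg hUk1]
      exact ⟨by exact_mod_cast one_sub_mul_pow_le hq h.1,
        by simpa using le_one_add_mul_pow (c := 1) hq (by simpa using h.2)⟩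
  · rw [Submodule.mem_bot]
    exact hv.1
  · rw [selfPerp_sup_span selfPerp_bot]
    exact ⟨by simp [perp_bot], hv.2.2⟩
  · rwa [bot_sup_eq]

theorem regularCodes_selfPerp_of_two_eq_zero (h2 : (2 : F) = 0) {k s₁ s₂ : ℕ}
    (hF : 2 < Fintype.card F) (hk : 3 ≤ k) (hn : 2 * k = Fintype.card ι) (hs : s₂ ≤ s₁)
    (hs₁ : s₁ < Fintype.card ι) (hs₂ : 2 * s₂ < Fintype.card ι) :
    RegularCodes {C : Submodule F (ι → F) | Module.finrank F C = k ∧ SelfPerp C} k s₁ s₂ := by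
  have hq : 0 < Fintype.card F := by omega
  have hone : SelfPerp (Submodule.span F {(1 : ι → F)}) :=
    selfPerp_span_one h2 ⟨k, by omega⟩
  have hone0 : (1 : ι → F) ≠ 0 := by
    obtain ⟨i⟩ := Fintype.card_pos_iff.1 (show 0 < Fintype.card ι by omega)
    exact fun h => one_ne_zero (congrFun h i)
  have h := regularCodes_of_convexFamily (G := SelfPerpOne) (k := k) (i₀ := 1) (s₁ := s₁)
    (s₂ := s₂) (U₀ := Submodule.span F {(1 : ι → F)})
    -- As the building starts at dimension 1, this choice gives the required values `q ^ (n - 1)`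
    -- and `q ^ (n - 2)` in the first two steps.
    (A := fun i => (Fintype.card F : ℝ) ^ (Fintype.card ι - i)) hF hs
    convexFamily_selfPerpOne ⟨hone, Submodule.mem_span_singleton_self _⟩
    (finrank_span_singleton hone0) (by omega) (fun i _ _ => by positivity) rfl rfl
    (fun U hU _ hUk => ?_) (fun v hv => ⟨?_, ?_⟩) (fun v hv w hw hvw hvw1 => ?_)
  · convert h using 3 with C
    constructor
    · rintro ⟨hCk, hC⟩
      have h1 := one_mem_of_selfPerp_of_two_mul_finrank h2 hC (by omega)
      exact ⟨hCk, ⟨hC, h1⟩, (Submodule.span_singleton_le_iff_mem _ _).2 h1⟩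
    · rintro ⟨hCk, hC, -⟩
      exact ⟨hCk, hC.1⟩
  · have h := stepCount_selfPerpOne h2 hU
    have h3 : Fintype.card F * Fintype.card F ^ Module.finrank F U ≤
        Fintype.card F ^ (Fintype.card ι - Module.finrank F U) := by
      rw [← pow_succ']
      exact Nat.pow_le_pow_right hq (by omega)
    have h4 := congrArg (fun x => Fintype.card F * x) h
    simp only [mul_add, ← pow_succ' _ (Fintype.card ι - Module.finrank F U)] at h4
    refine ⟨by exact_mod_cast one_sub_mul_pow_le hq (c := 2) (by omega), ?_⟩
    simpa using le_one_add_mul_pow (c := 1) hq (x := stepCount SelfPerpOne U)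
      (m := Fintype.card ι - Module.finrank F U) (by omega)
  · exact notMem_span_one_of_mem_lowWeight hs₁ hv
  · refine ⟨(selfPerp_sup_span hone).2 ⟨?_, hv.2.2⟩,
      Submodule.mem_sup_left (Submodule.mem_span_singleton_self _)⟩
    rw [mem_perp_span_singleton, ← dotProduct_self_eq_zero_iff_of_two_eq_zero h2]
    exact hv.2.2
  · obtain ⟨i, hvi, hwi⟩ := exists_eq_zero_eq_zero_of_mem_lowWeight hs₂ hv hw
    -- Evaluation at a common zero of `v` and `w` kills the coefficient of `1`.
    obtain ⟨x, hx, y, hy, hxy⟩ := Submodule.mem_sup.1 hvw1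
    obtain ⟨a, rfl⟩ := Submodule.mem_span_singleton.1 hx
    obtain ⟨b, rfl⟩ := Submodule.mem_span_singleton.1 hy
    have h3 := congrFun hxy i
    simp only [Pi.add_apply, Pi.smul_apply, Pi.one_apply, hvi, hwi, smul_eq_mul, mul_one,
      mul_zero, add_zero] at h3
    rw [h3, zero_smul, zero_add] at hxy
    exact hvw (Submodule.mem_span_singleton.2 ⟨b, hxy⟩)

end RegularCodes

/-! ### Self-dual codes of odd dimension -/

section Square

variable {F ι : Type*} [Field F] [Fintype ι]

/-- If there is a self-dual code of odd dimension, then `-1` is a square. -/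
theorem isSquare_neg_one_of_selfPerp {k : ℕ} (hk : Odd k) {C : Submodule F (ι → F)}
    (hC : SelfPerp C) (hCk : Module.finrank F C = k) (hn : 2 * k = Fintype.card ι) :
    IsSquare (-1 : F) := by
  classical
  let b := Module.finBasisOfFinrankEq F C hCk
  let M : Matrix (Fin k) ι F := Matrix.of fun i => (b i : ι → F)
  have hrow : LinearIndependent F M.row :=
    b.linearIndependent.map' C.subtype (Submodule.ker_subtype C)
  have hrank : M.rank = k := by
    rw [hrow.rank_matrix, Fintype.card_fin]
  -- Choose `k` independent columns of a generator matrix for an invertible block `A`; the other `k`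
  -- columns form `B`.
  obtain ⟨f', hf', -, hfi'⟩ := Submodule.exists_fun_fin_finrank_span_eq F (Set.range M.col)
  have hcard : k = Module.finrank F (Submodule.span F (Set.range M.col)) := by
    rw [← Matrix.rank_eq_finrank_span_cols, hrank]
  choose g' hg' using hf'
  let g : Fin k → ι := g' ∘ Fin.cast hcard
  have hfi : LinearIndependent F (fun i => M.col (g i)) := by
    have h : (fun i => M.col (g i)) = f' ∘ Fin.cast hcard := funext fun i => hg' _
    rw [h]
    exact hfi'.comp _ (Fin.cast_injective hcard)
  have hginj : Function.Injective g := by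
    intro i j hij
    exact hfi.injective (congrArg M.col hij)
  have hcompl : Fintype.card {x : ι // x ∉ Set.range g} = k := by
    have h1 := Fintype.card_subtype_compl fun x => x ∈ Set.range g
    have h2 : Fintype.card {x // x ∈ Set.range g} = k := by
      have := Set.card_range_of_injective hginj
      rw [Fintype.card_fin] at this
      convert this
    rw [h2] at h1
    convert h1 using 1
    omega
  let e := (Fintype.equivFinOfCardEq hcompl).symm
  let h : Fin k → ι := fun i => (e i : ι)
  have hbij : Function.Bijective (Sum.elim g h) := by
    rw [Fintype.bijective_iff_injective_and_card]
    constructor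
    · refine hginj.sumElim (Subtype.val_injective.comp e.injective) fun i j hij => ?_
      exact (e j).2 ⟨i, hij⟩
    · rw [Fintype.card_sum, Fintype.card_fin, ← hn, two_mul]
  let A := M.submatrix id g
  let B := M.submatrix id h
  have hAB : A * A.transpose + B * B.transpose = 0 := by
    ext i j
    rw [Matrix.add_apply, Matrix.mul_apply, Matrix.mul_apply, Matrix.zero_apply]
    have h1 : (b i : ι → F) ⬝ᵥ (b j : ι → F) = 0 := hC (b j).2 _ (b i).2
    rw [dotProduct, ← (Equiv.ofBijective _ hbij).sum_comp, Fintype.sum_sum_type] at h1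
    exact h1
  have hA : A.det ≠ 0 := by
    rw [← isUnit_iff_ne_zero, ← Matrix.isUnit_iff_isUnit_det,
      ← Matrix.linearIndependent_cols_iff_isUnit]
    exact hfi
  -- Self-orthogonality reads `A * Aᵀ = -(B * Bᵀ)`, and in odd size the sign survives the
  -- determinant.
  have hdet : A.det ^ 2 = -B.det ^ 2 := by
    have h2 := congrArg Matrix.det (eq_neg_of_add_eq_zero_left hAB)
    rw [Matrix.det_mul, Matrix.det_neg, Matrix.det_mul, Matrix.det_transpose,
      Matrix.det_transpose, Fintype.card_fin, hk.neg_one_pow] at h2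
    linear_combination h2
  have hB : B.det ≠ 0 := by
    intro h0
    rw [h0] at hdet
    exact hA (by simpa using hdet)
  refine ⟨A.det / B.det, ?_⟩
  field_simp
  linear_combination -hdet

end Square

/-! ### Codes with totally singular orthogonal are rare -/

section ContainingOne

variable {F ι : Type*} [Field F] [Fintype ι] [Fintype F]

/-- Only few self-orthogonal codes have a totally singular orthogonal. -/
theorem ncard_not_nonsingularPerp_le {k : ℕ} (hF : 2 < Fintype.card F) (hk : 2 ≤ k)
    (hn : 2 * k < Fintype.card ι) :
    ({C : Submodule F (ι → F) | Module.finrank F C = k ∧ SelfPerp C ∧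
        ¬ NonsingularPerp C}.ncard : ℝ) * (1 - 2 / (Fintype.card F : ℝ)) ^ k *
        (Fintype.card F : ℝ) ^ 2 ≤
      {C : Submodule F (ι → F) | Module.finrank F C = k ∧ NonsingularPerp C}.ncard := by
  classical
  have hq : 0 < Fintype.card F := by omega
  have hq1 : (1 : ℝ) < Fintype.card F := by exact_mod_cast (by omega : 1 < Fintype.card F)
  have hq2 : (2 : ℝ) < Fintype.card F := by exact_mod_cast hF
  have ha : (0 : ℝ) < 1 - 2 / (Fintype.card F : ℝ) := by
    rw [sub_pos, div_lt_one (by linarith)]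
    exact hq2
  by_cases hexists : ∃ C : Submodule F (ι → F), Module.finrank F C = k ∧ SelfPerp C ∧
      ¬ NonsingularPerp C
  swap
  · have h0 : {C : Submodule F (ι → F) | Module.finrank F C = k ∧ SelfPerp C ∧
        ¬ NonsingularPerp C} = ∅ := by
      rw [Set.eq_empty_iff_forall_notMem]
      exact fun C hC => hexists ⟨C, hC⟩
    rw [h0, Set.ncard_empty]
    simp
  obtain ⟨C₁, hC₁k, hC₁, hC₁n⟩ := hexists
  have h2 : (2 : F) = 0 := by
    by_contra h2
    refine hC₁n ⟨hC₁, exists_dotProduct_self_ne_zero h2 ?_⟩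
    have := finrank_perp_add C₁
    omega
  have hmem : ∀ C : Submodule F (ι → F), SelfPerp C → ¬ NonsingularPerp C → 1 ∈ C := by
    intro C hC hCn
    rw [← forall_dotProduct_self_perp_iff h2]
    by_contra! hc
    exact hCn ⟨hC, hc⟩
  have h1C := hmem C₁ hC₁ hC₁n
  have heven : Even (Fintype.card ι) := by
    have h3 := hC₁.dotProduct_self h1C
    rw [one_dotProduct_one] at h3
    have : CharP F 2 := CharTwo.of_one_ne_zero_of_two_eq_zero one_ne_zero h2
    exact even_iff_two_dvd.2 ((CharP.cast_eq_zero_iff F 2 _).1 h3)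
  -- An exceptional code contains `1`, so `n` is even and `2 * k < n` improves by one; this gives
  -- the second factor `q` in the saving.
  have hn2 : 2 * k + 2 ≤ Fintype.card ι := by
    obtain ⟨m, hm⟩ := heven
    omega
  have hone0 : (1 : ι → F) ≠ 0 := by
    obtain ⟨i⟩ := Fintype.card_pos_iff.1 (show 0 < Fintype.card ι by omega)
    exact fun h => one_ne_zero (congrFun h i)
  have hbot : NonsingularPerp (⊥ : Submodule F (ι → F)) := by
    obtain ⟨i⟩ := Fintype.card_pos_iff.1 (show 0 < Fintype.card ι by omega)
    exact ⟨selfPerp_bot, Pi.single i 1, by simp [perp_bot], by simp⟩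
  have hlow := le_extCount (k := k) (i₀ := 0) (j := 0) (G := NonsingularPerp (F := F) (ι := ι))
    convexFamily_nonsingularPerp (A := fun i => (Fintype.card F : ℝ) ^ (Fintype.card ι - 1 - i))
    ha.le (fun i _ _ => by positivity) (fun U hU _ hUk => by
      have h := stepCount_nonsingularPerp hU
        (m := Fintype.card ι - 1 - Module.finrank F U) (by omega) (by omega)
      exact_mod_cast one_sub_mul_pow_le hq h.1)
    (Nat.zero_le k) ⊥ hbot (Nat.zero_le _) (finrank_bot F _)
  have hup := extCount_le (k := k) (i₀ := 1) (j := 1) (G := SelfPerpOne (F := F) (ι := ι))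
    convexFamily_selfPerpOne (A := fun i => (Fintype.card F : ℝ) ^ (Fintype.card ι - i))
    zero_le_one (fun i _ _ => by positivity) (fun U hU _ hUk => by
      have h := stepCount_selfPerpOne h2 hU
      rw [one_mul]
      exact_mod_cast (by omega : stepCount SelfPerpOne U ≤
        Fintype.card F ^ (Fintype.card ι - Module.finrank F U)))
    (by omega) (Submodule.span F {1})
    ⟨hC₁.mono ((Submodule.span_singleton_le_iff_mem _ _).2 h1C),
      Submodule.mem_span_singleton_self _⟩
    (finrank_span_singleton hone0).ge (finrank_span_singleton hone0)
  have hset1 : extCount NonsingularPerp k (⊥ : Submodule F (ι → F)) =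
      {C : Submodule F (ι → F) | Module.finrank F C = k ∧ NonsingularPerp C}.ncard := by
    unfold extCount
    simp only [bot_le, and_true]
  have hset2 : {C : Submodule F (ι → F) | Module.finrank F C = k ∧ SelfPerp C ∧
      ¬ NonsingularPerp C}.ncard ≤
      extCount SelfPerpOne k (Submodule.span F {(1 : ι → F)}) := by
    refine Set.ncard_le_ncard fun C hC => ?_
    have := hmem C hC.2.1 hC.2.2
    exact ⟨hC.1, ⟨hC.2.1, this⟩, (Submodule.span_singleton_le_iff_mem _ _).2 this⟩
  rw [hset1] at hlow
  set q : ℝ := (Fintype.card F : ℝ)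
  set n := Fintype.card ι
  -- Building from `⟨1⟩` gains one factor `q` in each of the `k - 1` remaining steps.
  have hshift : extMain q (fun i => q ^ (n - i)) k 1 =
      q ^ (k - 1) * extMain q (fun i => q ^ (n - 1 - i)) k 1 := by
    unfold extMain
    rw [← Nat.card_Ico 1 k, ← Finset.prod_const, ← Finset.prod_mul_distrib]
    refine Finset.prod_congr rfl fun i hi => ?_
    rw [Finset.mem_Ico] at hi
    rw [← mul_div_assoc, ← pow_succ', show n - 1 - i + 1 = n - i by omega]
  have hrec := extMain_mul hq1 (fun i => q ^ (n - 1 - i)) (show 0 < k by omega)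
  simp only [Nat.sub_zero, pow_zero, zero_add] at hrec
  rw [one_pow, one_mul, hshift] at hup
  have hE := extMain_pos hq1 (A := fun i => q ^ (n - 1 - i)) (k := k) (j := 0)
    fun i _ _ => by positivity
  have hE1 := extMain_pos hq1 (A := fun i => q ^ (n - 1 - i)) (k := k) (j := 1)
    fun i _ _ => by positivity
  -- Building from zero has the extra first factor `q ^ (n - 1) / (q ^ k - 1)`, which is at least `q
  -- ^ (k + 1)`. It outweighs that gain by `q ^ 2`.
  have hkey : q ^ (k - 1) * extMain q (fun i => q ^ (n - 1 - i)) k 1 * q ^ 2 ≤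
      extMain q (fun i => q ^ (n - 1 - i)) k 0 := by
    have h3 : q ^ (k + 1) * q ^ k * extMain q (fun i => q ^ (n - 1 - i)) k 1 ≤
        q ^ k * extMain q (fun i => q ^ (n - 1 - i)) k 0 := by
      calc _ ≤ q ^ (n - 1) * extMain q (fun i => q ^ (n - 1 - i)) k 1 := by
            rw [← pow_add]
            gcongr
            · exact hq1.le
            · omega
        _ = extMain q (fun i => q ^ (n - 1 - i)) k 0 * (q ^ k - 1) := hrec.symm
        _ ≤ _ := by
            rw [mul_comm]
            gcongr
            linarith
    have h4 : q ^ (k - 1) * q ^ 2 = q ^ (k + 1) := by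
      rw [← pow_add]
      congr 1
      omega
    refine le_of_mul_le_mul_left (a := q ^ k) ?_ (by positivity)
    calc _ = (q ^ (k - 1) * q ^ 2) * q ^ k * extMain q (fun i => q ^ (n - 1 - i)) k 1 := by ring
      _ ≤ _ := by rw [h4]; exact h3
  have hcast : ({C : Submodule F (ι → F) | Module.finrank F C = k ∧ SelfPerp C ∧
      ¬ NonsingularPerp C}.ncard : ℝ) ≤
      q ^ (k - 1) * extMain q (fun i => q ^ (n - 1 - i)) k 1 :=
    le_trans (by exact_mod_cast hset2) hup
  calc _ ≤ (q ^ (k - 1) * extMain q (fun i => q ^ (n - 1 - i)) k 1) * (1 - 2 / q) ^ k * q ^ 2 := by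
        gcongr
    _ = (1 - 2 / q) ^ k * (q ^ (k - 1) * extMain q (fun i => q ^ (n - 1 - i)) k 1 * q ^ 2) := by
        ring
    _ ≤ (1 - 2 / q) ^ k * extMain q (fun i => q ^ (n - 1 - i)) k 0 := by gcongr
    _ ≤ _ := hlow

end ContainingOne

/-! ### Minimum distance in terms of singular vectors -/

section MinDist

variable {F : Type} [Field F] {n : ℕ}

theorem selfOrthCodes_eq (k : ℕ) :
    selfOrthCodes F n k = {C : Submodule F (Fin n → F) | Module.finrank F C = k ∧ SelfPerp C} := rfl

theorem minDist_le_iff {C : Submodule F (Fin n → F)} (hC : SelfPerp C)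
    (hC0 : 0 < Module.finrank F C) {s : ℕ} :
    minDist C ≤ s ↔ ∃ v ∈ lowWeight F (Fin n) s, v ∈ C := by
  classical
  constructor
  · intro h
    obtain ⟨v, hvC, hv0⟩ := Submodule.exists_mem_ne_zero_of_ne_bot
      (p := C) (fun h0 => by rw [h0, finrank_bot] at hC0; omega)
    have hne : {t : ℕ | ∃ v ∈ C, v ≠ 0 ∧ hammingNorm v = t}.Nonempty :=
      ⟨_, v, hvC, hv0, rfl⟩
    obtain ⟨w, hwC, hw0, hw⟩ := Nat.sInf_mem hne
    refine ⟨w, ⟨hw0, ?_, hC.dotProduct_self hwC⟩, hwC⟩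
    convert h
    rw [minDist]
    convert hw
  · rintro ⟨v, ⟨hv0, hvs, -⟩, hvC⟩
    have h : minDist C ≤ hammingNorm v := Nat.sInf_le ⟨v, hvC, hv0, by congr⟩
    exact h.trans (by convert hvs)

end MinDist

/-! ### Explicit bounds for finite `q` -/

section FiniteBounds

variable {F ι : Type*} [Field F] [Fintype ι]

theorem zero_notMem_lowWeight (s : ℕ) : (0 : ι → F) ∉ lowWeight F ι s := fun h => h.1 rfl

theorem smul_mem_lowWeight {s : ℕ} {v : ι → F} (hv : v ∈ lowWeight F ι s) {c : F}
    (hc : c ≠ 0) : c • v ∈ lowWeight F ι s := by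
  classical
  refine ⟨smul_ne_zero hc hv.1, ?_, ?_⟩
  · refine le_trans (le_of_eq ?_) hv.2.1
    unfold hammingNorm
    congr 1
    ext i
    simp [hc]
  · rw [smul_dotProduct, dotProduct_smul, hv.2.2, smul_zero, smul_zero]

/-- The upper bound for the proportion of codes with vectors of small weight. -/
def upperBound (c : ℝ) (k : ℕ) (q : ℝ) : ℝ :=
  c * (1 + 1 / q) * errorFactor q k * (q / (q - 1))

/-- The lower bound for the proportion of codes with vectors of small weight. -/
def lowerBound (c b K : ℝ) (k : ℕ) (q : ℝ) : ℝ :=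
  (c * (1 - b / q) * (1 - 1 / q) * (errorFactor q k)⁻¹ - K * errorFactor q k / (q - 1)) *
    (q / (q - 1))

theorem errorFactor_pos {q : ℝ} (hq : 2 < q) (k : ℕ) : 0 < errorFactor q k := by
  have ha : (0 : ℝ) < 1 - 2 / q := by
    rw [sub_pos, div_lt_one (by linarith)]
    exact hq
  have : 0 < q := by linarith
  unfold errorFactor
  positivity

variable [Fintype F]

theorem RegularCodes.mul_div_le {𝒞 : Set (Submodule F (ι → F))} {k m s₂ : ℕ}
    (h : RegularCodes 𝒞 k (m + 1) s₂) (hF : 2 < Fintype.card F) (hm : 2 ≤ m)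
    (hn : m + k + 1 = Fintype.card ι) :
    (Fintype.card F : ℝ) *
      (({C | C ∈ 𝒞 ∧ ∃ v ∈ lowWeight F ι (m + 1), v ∈ C}.ncard : ℝ) / 𝒞.ncard) ≤
      upperBound ((Fintype.card ι).choose (m + 1)) k (Fintype.card F) := by
  have hq : (2 : ℝ) < Fintype.card F := by exact_mod_cast hF
  have hL := ncard_lowWeight_le (F := F) (ι := ι) (s := m + 1) (by omega)
    fun S hS => (card_mul_ncard_isoSupp S hS hm).2
  have hL' : (Fintype.card F : ℝ) * ((lowWeight F ι (m + 1)).ncard : ℝ) ≤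
      (Fintype.card ι).choose (m + 1) *
        ((Fintype.card F : ℝ) ^ (m + 1) + (Fintype.card F : ℝ) ^ m) := by exact_mod_cast hL
  have hr := errorFactor_pos hq k
  have hN : (0 : ℝ) < 𝒞.ncard := by exact_mod_cast h.pos
  have hmom := ncard_meet_mul_le (zero_notMem_lowWeight (F := F) (ι := ι) (m + 1))
    (fun v hv c hc => smul_mem_lowWeight hv hc) (𝒞 := 𝒞)
    (β := errorFactor (Fintype.card F) k * 𝒞.ncard / (Fintype.card F : ℝ) ^ m)
    (fun v hv => by
      have h1 := h.le_one v hv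
      rw [show Fintype.card ι - 1 = m + k by omega, pow_add] at h1
      have hq0 : (0 : ℝ) < Fintype.card F := by linarith
      rw [le_div_iff₀ (by positivity)]
      refine le_of_mul_le_mul_right (a := (Fintype.card F : ℝ) ^ k) ?_ (by positivity)
      linarith)
  set q : ℝ := (Fintype.card F : ℝ)
  set B : ℝ := ({C | C ∈ 𝒞 ∧ ∃ v ∈ lowWeight F ι (m + 1), v ∈ C}.ncard : ℝ)
  set N : ℝ := (𝒞.ncard : ℝ)
  set c : ℝ := ((Fintype.card ι).choose (m + 1) : ℝ)
  set r := errorFactor q k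
  set X : ℝ := ((lowWeight F ι (m + 1)).ncard : ℝ)
  have hq0 : 0 < q := by linarith
  have hX : X ≤ c * (1 + 1 / q) * q ^ m := by
    refine le_of_mul_le_mul_left (hL'.trans (le_of_eq ?_)) hq0
    field_simp
    ring
  have hB : B * (q - 1) ≤ c * (1 + 1 / q) * r * N := by
    calc B * (q - 1) ≤ X * (r * N / q ^ m) := hmom
      _ ≤ (c * (1 + 1 / q) * q ^ m) * (r * N / q ^ m) := by gcongr
      _ = _ := by field_simp
  have hq1 : 0 < q - 1 := by linarith
  unfold upperBound
  rw [mul_div_assoc', div_le_iff₀ hN, mul_div_assoc', div_mul_eq_mul_div, le_div_iff₀ hq1]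
  calc q * B * (q - 1) = q * (B * (q - 1)) := by ring
    _ ≤ q * (c * (1 + 1 / q) * r * N) := by gcongr
    _ = _ := by ring

/-- Here `f` measures how far the weight `m + 1` falls below `n - k`: it is 0 when `2 * k < n` and 1
when `2 * k = n`. The main term has order `q ^ (-f - 1)`; with the assumed bound on `P`, the pairs
contribute one power of `q` less. -/
theorem RegularCodes.le_pow_mul_div {𝒞 : Set (Submodule F (ι → F))} {k m s₁ f K : ℕ}
    (h : RegularCodes 𝒞 k s₁ (m + 1)) (hF : 2 < Fintype.card F) (hs : m + 1 ≤ s₁) (hm : 1 ≤ m)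
    (hmF : 2 ≤ m ∨ IsSquare (-1 : F)) (hk : 1 ≤ k) (hn : m + k + f + 1 = Fintype.card ι)
    {P : Set ((ι → F) × (ι → F))}
    (hP : Fintype.card F ^ 2 * P.ncard ≤ K * Fintype.card F ^ (2 * m + f + 1))
    (hCP : ∀ v ∈ lowWeight F ι (m + 1), ∀ w ∈ lowWeight F ι (m + 1), ∀ C ∈ 𝒞,
      v ∈ C → w ∈ C → (v, w) ∈ P) :
    lowerBound ((Fintype.card ι).choose (m + 1)) (2 * m + 3) K k (Fintype.card F) ≤
    (Fintype.card F : ℝ) ^ (f + 1) *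
      (({C | C ∈ 𝒞 ∧ ∃ v ∈ lowWeight F ι (m + 1), v ∈ C}.ncard : ℝ) / 𝒞.ncard) := by
  have hq : (2 : ℝ) < Fintype.card F := by exact_mod_cast hF
  have hL := le_ncard_lowWeight (F := F) (ι := ι) (s := m + 1) (by omega)
    fun S hS => le_card_mul_ncard_isoSuppEq S hS hm hmF
  have hL' : (Fintype.card ι).choose (m + 1) * (Fintype.card F : ℝ) ^ (m + 1) ≤
      (Fintype.card F : ℝ) * ((lowWeight F ι (m + 1)).ncard : ℝ) +
      (Fintype.card ι).choose (m + 1) * ((2 * m + 3) * (Fintype.card F : ℝ) ^ m) := by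
    exact_mod_cast hL
  have hP' : (Fintype.card F : ℝ) ^ 2 * (P.ncard : ℝ) ≤
      K * (Fintype.card F : ℝ) ^ (2 * m + f + 1) := by exact_mod_cast hP
  have hr := errorFactor_pos hq k
  have hN : (0 : ℝ) < 𝒞.ncard := by exact_mod_cast h.pos
  have hq0 : (0 : ℝ) < Fintype.card F := by linarith
  have hkk : (Fintype.card F : ℝ) ^ k = (Fintype.card F : ℝ) ^ (k - 1) * Fintype.card F := by
    rw [← pow_succ, show k - 1 + 1 = k by omega]
  have hn2 : (Fintype.card F : ℝ) ^ (Fintype.card ι - 2) * Fintype.card F =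
      (Fintype.card F : ℝ) ^ m * (Fintype.card F : ℝ) ^ k * (Fintype.card F : ℝ) ^ f := by
    rw [← pow_succ, ← pow_add, ← pow_add]
    congr 1
    omega
  have hmom := le_ncard_meet_mul (zero_notMem_lowWeight (F := F) (ι := ι) (m + 1))
    (fun v hv c hc => smul_mem_lowWeight hv hc) (𝒞 := 𝒞)
    (α := (errorFactor (Fintype.card F) k)⁻¹ * (1 - 1 / (Fintype.card F : ℝ)) * 𝒞.ncard /
      ((Fintype.card F : ℝ) ^ m * (Fintype.card F : ℝ) ^ f))
    (γ := errorFactor (Fintype.card F) k * 𝒞.ncard * (Fintype.card F : ℝ) /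
      ((Fintype.card F : ℝ) ^ m * (Fintype.card F : ℝ) ^ f) ^ 2)
    (fun v hv => by
      have h1 := h.one_le v (lowWeight_mono hs hv)
      rw [show Fintype.card ι - 1 = m + k + f by omega, pow_add, pow_add] at h1
      rw [div_le_iff₀ (by positivity)]
      refine le_of_mul_le_mul_right (a := (Fintype.card F : ℝ) ^ k) ?_ (by positivity)
      refine le_trans (le_of_eq ?_) (h1.trans (le_of_eq (by ring)))
      rw [hkk]
      field_simp)
    (P := P) (by positivity)
    (fun v hv w hw hvw => by
      have h1 := h.le_two v hv w hw hvw
      rw [show Fintype.card ι - 1 = m + k + f by omega, pow_add, pow_add] at h1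
      rw [le_div_iff₀ (by positivity)]
      refine le_of_mul_le_mul_right
        (a := (Fintype.card F : ℝ) ^ k * (Fintype.card F : ℝ) ^ k) ?_ (by positivity)
      have h2 := mul_le_mul_of_nonneg_right h1 hq0.le
      refine le_trans (le_of_eq ?_) (h2.trans (le_of_eq (by ring)))
      rw [mul_assoc _ _ (Fintype.card F : ℝ), mul_assoc _ _ (Fintype.card F : ℝ), hn2]
      ring)
    hCP
  set q : ℝ := (Fintype.card F : ℝ)
  set B : ℝ := ({C | C ∈ 𝒞 ∧ ∃ v ∈ lowWeight F ι (m + 1), v ∈ C}.ncard : ℝ)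
  set N : ℝ := (𝒞.ncard : ℝ)
  set c : ℝ := ((Fintype.card ι).choose (m + 1) : ℝ)
  set r := errorFactor q k
  set X : ℝ := ((lowWeight F ι (m + 1)).ncard : ℝ)
  have hq1 : 0 < q - 1 := by linarith
  have hX : c * (1 - (2 * m + 3) / q) * q ^ m ≤ X := by
    refine le_of_mul_le_mul_left ?_ hq0
    have : q * (c * (1 - (2 * m + 3) / q) * q ^ m) =
        c * q ^ (m + 1) - c * ((2 * m + 3) * q ^ m) := by
      field_simp
      ring
    linarith
  have hPn : (P.ncard : ℝ) ≤ K * ((q ^ m) ^ 2 * q ^ f / q) := by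
    refine le_of_mul_le_mul_left (hP'.trans (le_of_eq ?_)) (by positivity : 0 < q ^ 2)
    field_simp
    ring
  have h1q : 0 ≤ 1 - 1 / q := by
    rw [sub_nonneg, div_le_one hq0]
    linarith
  have hmain : (q - 1) * (c * (1 - (2 * m + 3) / q) * (1 - 1 / q) * r⁻¹) * N ≤
      (q - 1) ^ 2 * (q ^ f * B) + K * r * N := by
    have h1 : (q - 1) * ((c * (1 - (2 * m + 3) / q) * q ^ m) *
        (r⁻¹ * (1 - 1 / q) * N / (q ^ m * q ^ f))) ≤ (q - 1) ^ 2 * B +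
        K * ((q ^ m) ^ 2 * q ^ f / q) * (r * N * q / (q ^ m * q ^ f) ^ 2) := by
      refine le_trans ?_ (hmom.trans ?_)
      · gcongr
      · gcongr
    have h2 := mul_le_mul_of_nonneg_right h1 (by positivity : 0 ≤ q ^ f)
    refine le_trans (le_of_eq ?_) (h2.trans (le_of_eq ?_))
    · field_simp
    · field_simp
  unfold lowerBound
  rw [show errorFactor q k = r from rfl, mul_div_assoc' (q ^ (f + 1)), le_div_iff₀ hN]
  refine le_of_mul_le_mul_right (a := (q - 1) ^ 2) ?_ (by positivity)
  calc _ = q * ((q - 1) * (c * (1 - (2 * m + 3) / q) * (1 - 1 / q) * r⁻¹) * N - K * r * N) := by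
        field_simp
    _ ≤ q * ((q - 1) ^ 2 * (q ^ f * B)) := by
        gcongr
        linarith
    _ = _ := by ring

end FiniteBounds

/-! ### Limits of the explicit bounds -/

section Asymptotics

theorem tendsto_const_div_atTop (c : ℝ) : Tendsto (fun q : ℝ => c / q) atTop (𝓝 0) :=
  tendsto_const_nhds.div_atTop tendsto_id

theorem tendsto_errorFactor (k : ℕ) : Tendsto (fun q => errorFactor q k) atTop (𝓝 1) := by
  have h := (((tendsto_const_div_atTop 1).const_add 1).div
    ((tendsto_const_div_atTop 2).const_sub 1) (by norm_num)).pow k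
  simpa [errorFactor] using h

theorem tendsto_div_sub_one : Tendsto (fun q : ℝ => q / (q - 1)) atTop (𝓝 1) := by
  have h : Tendsto (fun q : ℝ => (1 - 1 / q)⁻¹) atTop (𝓝 1) := by
    simpa using ((tendsto_const_div_atTop 1).const_sub 1).inv₀ (by norm_num)
  refine h.congr' ?_
  filter_upwards [eventually_gt_atTop 1] with q hq
  have h1 : q - 1 ≠ 0 := by linarith
  have h2 : q ≠ 0 := by linarith
  rw [one_sub_div h2, inv_div]

theorem tendsto_upperBound (c : ℝ) (k : ℕ) : Tendsto (fun q => upperBound c k q) atTop (𝓝 c) := by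
  have h := ((((tendsto_const_div_atTop 1).const_add 1).const_mul c).mul
    (tendsto_errorFactor k)).mul tendsto_div_sub_one
  simpa [upperBound] using h

theorem tendsto_lowerBound (c b K : ℝ) (k : ℕ) :
    Tendsto (fun q => lowerBound c b K k q) atTop (𝓝 c) := by
  have h1 : Tendsto (fun q : ℝ => q - 1) atTop atTop := tendsto_atTop_add_const_right _ _ tendsto_id
  have h := (((((tendsto_const_div_atTop b).const_sub 1).const_mul c).mul
    ((tendsto_const_div_atTop 1).const_sub 1)).mul
      ((tendsto_errorFactor k).inv₀ one_ne_zero)).sub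
    (((tendsto_errorFactor k).const_mul K).div_atTop h1)
  simpa [lowerBound] using h.mul tendsto_div_sub_one

end Asymptotics

/-! ### Bounds for the proportion -/

section Proportion

variable {F : Type} [Field F] {n : ℕ}

theorem proportion_eq {k d : ℕ} (hk : 0 < k) :
    proportion F n k d =
      ({C | C ∈ {C : Submodule F (Fin n → F) | Module.finrank F C = k ∧ SelfPerp C} ∧
        ∃ v ∈ lowWeight F (Fin n) (d - 1), v ∈ C}.ncard : ℝ) /
      ({C : Submodule F (Fin n → F) | Module.finrank F C = k ∧ SelfPerp C}.ncard : ℝ) := by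
  rw [proportion, selfOrthCodes_eq]
  congr 3
  ext C
  refine and_congr_right fun hC => ?_
  rw [minDist_le_iff hC.2 (by rw [hC.1]; exact hk)]

/-- The relative number of self-orthogonal codes with totally singular orthogonal. -/
def singularBound (k : ℕ) (q : ℝ) : ℝ := ((1 - 2 / q) ^ k)⁻¹ / q ^ 2

theorem tendsto_mul_singularBound (k : ℕ) :
    Tendsto (fun q => q * singularBound k q) atTop (𝓝 0) := by
  have h : Tendsto (fun q : ℝ => ((1 - 2 / q) ^ k)⁻¹ * (1 / q)) atTop (𝓝 0) := by
    simpa using ((((tendsto_const_div_atTop 2).const_sub 1).pow k).inv₀ (by norm_num)).mul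
      (tendsto_const_div_atTop 1)
  refine h.congr' ?_
  filter_upwards [eventually_gt_atTop 0] with q hq
  unfold singularBound
  field_simp

theorem tendsto_singularBound (k : ℕ) : Tendsto (fun q => singularBound k q) atTop (𝓝 0) := by
  have h := (tendsto_mul_singularBound k).mul (tendsto_const_div_atTop 1)
  rw [zero_mul] at h
  refine h.congr' ?_
  filter_upwards [eventually_gt_atTop 0] with q hq
  field_simp

/-- Self-orthogonal codes have dimension at most `n / 2 = k`, so a code attaining the Witt index has
dimension exactly `k`. -/
theorem exists_selfPerp_of_le_wittIndex {k : ℕ} (hk : k ≤ wittIndex F n) (hkn : 2 * k = n) :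
    ∃ C : Submodule F (Fin n → F), SelfPerp C ∧ Module.finrank F C = k := by
  have hle : ∀ C : Submodule F (Fin n → F), SelfPerp C → 2 * Module.finrank F C ≤ n := by
    intro C hC
    have := hC.two_mul_finrank_le
    rwa [Fintype.card_fin] at this
  have hbdd : BddAbove {m : ℕ | ∃ C : Submodule F (Fin n → F), IsSelfOrthogonal C ∧
      Module.finrank F C = m} := by
    refine ⟨n, ?_⟩
    rintro m ⟨C, hC, rfl⟩
    have := hle C hC
    omega
  obtain ⟨C, hC, hCm⟩ := Nat.sSup_mem
    (s := {m : ℕ | ∃ C : Submodule F (Fin n → F), IsSelfOrthogonal C ∧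
      Module.finrank F C = m}) ⟨0, ⊥, bot_le, finrank_bot F _⟩ hbdd
  refine ⟨C, hC, ?_⟩
  have h1 := hle C hC
  unfold wittIndex at hk
  omega

variable [Fintype F]

/-- The moment bounds hold for codes with nonsingular orthogonal. Passing to all self-orthogonal
codes changes numerator and denominator by at most a `singularBound` fraction of these codes. -/
theorem proportion_bounds_of_two_mul_lt {k d : ℕ} (hF : 2 < Fintype.card F) (hd : 4 ≤ d)
    (hdn : d < n) (hk : k = n - d + 1) (hkn : 2 * k < n) :
    (Fintype.card F : ℝ) * proportion F n k d ≤
      upperBound (n.choose k) k (Fintype.card F) +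
        Fintype.card F * singularBound k (Fintype.card F) ∧
    lowerBound (n.choose k) (2 * (d - 2 : ℕ) + 3) ((n.choose k) ^ 2 * 8 : ℕ) k (Fintype.card F) /
      (1 + singularBound k (Fintype.card F)) ≤ (Fintype.card F : ℝ) * proportion F n k d := by
  have hq : (2 : ℝ) < Fintype.card F := by exact_mod_cast hF
  have hchoose : n.choose k = n.choose (d - 2 + 1) := by
    rw [← Nat.choose_symm (show k ≤ n by omega)]
    congr 1
    omega
  have hreg := regularCodes_nonsingularPerp (F := F) (ι := Fin n) (k := k) (s := d - 2 + 1) hF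
    (by omega) (by rwa [Fintype.card_fin]) (by rw [Fintype.card_fin]; omega)
  have hup := hreg.mul_div_le hF (by omega) (by rw [Fintype.card_fin]; omega)
  have hpairs := sq_mul_ncard_lowWeight_pairs_le (F := F) (ι := Fin n) (m := d - 2) (by omega)
    (by rw [Fintype.card_fin]; omega) (by rw [Fintype.card_fin]; omega)
  rw [← mul_assoc] at hpairs
  have hlow := hreg.le_pow_mul_div hF le_rfl (by omega) (Or.inl (by omega)) (by omega) (f := 0)
    (by rw [Fintype.card_fin]; omega) hpairs
    (fun v hv w hw C hC hvC hwC => ⟨hv, hw, hC.2.1 hwC v hvC⟩)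
  have hsing := ncard_not_nonsingularPerp_le (F := F) (ι := Fin n) hF (by omega : 2 ≤ k)
    (by rwa [Fintype.card_fin])
  rw [Fintype.card_fin, ← hchoose] at hup hlow
  rw [zero_add, pow_one] at hlow
  rw [proportion_eq (by omega), show d - 1 = d - 2 + 1 by omega]
  have hNpos : (0 : ℝ) < ({C : Submodule F (Fin n → F) |
    Module.finrank F C = k ∧ NonsingularPerp C}.ncard : ℝ) := by exact_mod_cast hreg.pos
  have hsub : {C : Submodule F (Fin n → F) | Module.finrank F C = k ∧ NonsingularPerp C} ⊆
      {C : Submodule F (Fin n → F) | Module.finrank F C = k ∧ SelfPerp C} :=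
    fun C hC => ⟨hC.1, hC.2.1⟩
  have h1 := Set.ncard_le_ncard hsub
  have h2 : {C : Submodule F (Fin n → F) | Module.finrank F C = k ∧ SelfPerp C}.ncard ≤
      {C : Submodule F (Fin n → F) | Module.finrank F C = k ∧ NonsingularPerp C}.ncard +
      {C : Submodule F (Fin n → F) | Module.finrank F C = k ∧ SelfPerp C ∧
        ¬ NonsingularPerp C}.ncard := by
    refine le_trans (Set.ncard_le_ncard fun C hC => ?_) (Set.ncard_union_le _ _)
    by_cases hCn : NonsingularPerp C
    · exact Or.inl ⟨hC.1, hCn⟩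
    · exact Or.inr ⟨hC.1, hC.2, hCn⟩
  have h3 : {C | C ∈ {C : Submodule F (Fin n → F) | Module.finrank F C = k ∧
        NonsingularPerp C} ∧ ∃ v ∈ lowWeight F (Fin n) (d - 2 + 1), v ∈ C}.ncard ≤
      {C | C ∈ {C : Submodule F (Fin n → F) | Module.finrank F C = k ∧ SelfPerp C} ∧
        ∃ v ∈ lowWeight F (Fin n) (d - 2 + 1), v ∈ C}.ncard :=
    Set.ncard_le_ncard fun C hC => ⟨hsub hC.1, hC.2⟩
  have h4 : {C | C ∈ {C : Submodule F (Fin n → F) | Module.finrank F C = k ∧ SelfPerp C} ∧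
        ∃ v ∈ lowWeight F (Fin n) (d - 2 + 1), v ∈ C}.ncard ≤
      {C | C ∈ {C : Submodule F (Fin n → F) | Module.finrank F C = k ∧
        NonsingularPerp C} ∧ ∃ v ∈ lowWeight F (Fin n) (d - 2 + 1), v ∈ C}.ncard +
      {C : Submodule F (Fin n → F) | Module.finrank F C = k ∧ SelfPerp C ∧
        ¬ NonsingularPerp C}.ncard := by
    refine le_trans (Set.ncard_le_ncard fun C hC => ?_) (Set.ncard_union_le _ _)
    by_cases hCn : NonsingularPerp C
    · exact Or.inl ⟨⟨hC.1.1, hCn⟩, hC.2⟩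
    · exact Or.inr ⟨hC.1.1, hC.1.2, hCn⟩
  set q : ℝ := (Fintype.card F : ℝ)
  set δ : ℝ := singularBound k q with hδ
  set B := {C | C ∈ {C : Submodule F (Fin n → F) | Module.finrank F C = k ∧
        NonsingularPerp C} ∧ ∃ v ∈ lowWeight F (Fin n) (d - 2 + 1), v ∈ C}.ncard
  set B' := {C | C ∈ {C : Submodule F (Fin n → F) | Module.finrank F C = k ∧ SelfPerp C} ∧
        ∃ v ∈ lowWeight F (Fin n) (d - 2 + 1), v ∈ C}.ncard
  set N := {C : Submodule F (Fin n → F) | Module.finrank F C = k ∧ NonsingularPerp C}.ncard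
  set N' := {C : Submodule F (Fin n → F) | Module.finrank F C = k ∧ SelfPerp C}.ncard
  set D := {C : Submodule F (Fin n → F) | Module.finrank F C = k ∧ SelfPerp C ∧
        ¬ NonsingularPerp C}.ncard
  have hq0 : 0 < q := by linarith
  have ha : (0 : ℝ) < 1 - 2 / q := by
    rw [sub_pos, div_lt_one hq0]
    exact hq
  have hδ0 : 0 ≤ δ := by
    rw [hδ, singularBound]
    positivity
  have hD : (D : ℝ) ≤ δ * N := by
    rw [hδ, singularBound, div_mul_eq_mul_div, le_div_iff₀ (by positivity),
      inv_mul_eq_div, le_div_iff₀ (by positivity)]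
    linarith
  have h1' : (N : ℝ) ≤ N' := by exact_mod_cast h1
  have h2' : (N' : ℝ) ≤ N + D := by exact_mod_cast h2
  have h3' : (B : ℝ) ≤ B' := by exact_mod_cast h3
  have h4' : (B' : ℝ) ≤ B + D := by exact_mod_cast h4
  constructor
  · calc q * (B' / N') ≤ q * ((B + δ * N) / N) := by
          gcongr
          linarith
      _ = q * (B / N) + q * δ := by field_simp
      _ ≤ _ := by gcongr
  · rw [div_le_iff₀ (by positivity)]
    refine hlow.trans ?_
    rw [mul_assoc]
    refine mul_le_mul_of_nonneg_left ?_ hq0.le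
    rw [div_mul_eq_mul_div, div_le_div_iff₀ hNpos (by linarith)]
    calc (B : ℝ) * N' ≤ B' * (N + δ * N) := by gcongr; linarith
      _ = _ := by ring

theorem proportion_bounds_of_two_mul_eq {k d : ℕ} (hF : 2 < Fintype.card F) (hd : 4 ≤ d)
    (hdn : d < n) (hk : k = n - d + 1) (hkn : 2 * k = n) (hw : k ≤ wittIndex F n) :
    (Fintype.card F : ℝ) * proportion F n k d ≤
      upperBound (n.choose (d - 1)) k (Fintype.card F) ∧
    lowerBound (n.choose (d - 2)) (2 * (d - 3 : ℕ) + 3) ((n.choose (d - 2)) ^ 2 * 4 : ℕ) k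
      (Fintype.card F) ≤ (Fintype.card F : ℝ) ^ 2 * proportion F n k d := by
  have hq : (2 : ℝ) < Fintype.card F := by exact_mod_cast hF
  obtain ⟨C₀, hC₀, hC₀k⟩ := exists_selfPerp_of_le_wittIndex hw hkn
  have hreg : RegularCodes {C : Submodule F (Fin n → F) | Module.finrank F C = k ∧ SelfPerp C}
      k (d - 2 + 1) (d - 3 + 1) := by
    by_cases h2 : (2 : F) = 0
    · exact regularCodes_selfPerp_of_two_eq_zero h2 hF (by omega)
        (by rwa [Fintype.card_fin]) (by omega) (by rw [Fintype.card_fin]; omega)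
        (by rw [Fintype.card_fin]; omega)
    · exact regularCodes_selfPerp_of_two_ne_zero h2 hF (by omega)
        (by rwa [Fintype.card_fin]) (by omega) hC₀ hC₀k
  have hup := hreg.mul_div_le hF (by omega) (by rw [Fintype.card_fin]; omega)
  -- Supports of size `d - 2` carry enough singular vectors once `d ≥ 5`. For `d = 4` one has `k =
  -- 3`, which is odd, so `-1` is a square.
  have hsq : 2 ≤ d - 3 ∨ IsSquare (-1 : F) := by
    rcases Nat.lt_or_ge d 5 with h5 | h5
    · have hk3 : k = 3 := by omega
      exact Or.inr (isSquare_neg_one_of_selfPerp (k := 3) (by decide) hC₀ (hk3 ▸ hC₀k)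
        (by rw [Fintype.card_fin]; omega))
    · exact Or.inl (by omega)
  have hL := ncard_lowWeight_le (F := F) (ι := Fin n) (s := d - 3 + 1)
    (by rw [Fintype.card_fin]; omega)
    fun S hS => (card_mul_ncard_isoSupp_le S (Finset.card_pos.1 (by omega))).trans_eq
      (by rw [hS])
  -- All pairs are admitted here: lowering the weight to `d - 2` already makes their contribution
  -- negligible, without using orthogonality.
  have hpairs : Fintype.card F ^ 2 * (lowWeight F (Fin n) (d - 3 + 1) ×ˢ
      lowWeight F (Fin n) (d - 3 + 1)).ncard ≤
      (n.choose (d - 3 + 1)) ^ 2 * 4 * Fintype.card F ^ (2 * (d - 3) + 1 + 1) := by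
    rw [Set.ncard_prod]
    rw [Fintype.card_fin] at hL
    calc _ = (Fintype.card F * (lowWeight F (Fin n) (d - 3 + 1)).ncard) *
          (Fintype.card F * (lowWeight F (Fin n) (d - 3 + 1)).ncard) := by ring
      _ ≤ _ := Nat.mul_le_mul hL hL
      _ = _ := by ring
  have hlow := hreg.le_pow_mul_div hF (by omega) (by omega) hsq (by omega) (f := 1)
    (by rw [Fintype.card_fin]; omega) hpairs
    (fun v hv w hw C _ _ _ => ⟨hv, hw⟩)
  rw [Fintype.card_fin] at hup hlow
  rw [proportion_eq (by omega)]
  rw [show d - 2 + 1 = d - 1 by omega] at hup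
  rw [show d - 3 + 1 = d - 2 by omega] at hlow
  refine ⟨hup, hlow.trans ?_⟩
  have : {C | C ∈ {C : Submodule F (Fin n → F) | Module.finrank F C = k ∧ SelfPerp C} ∧
        ∃ v ∈ lowWeight F (Fin n) (d - 2), v ∈ C}.ncard ≤
      {C | C ∈ {C : Submodule F (Fin n → F) | Module.finrank F C = k ∧ SelfPerp C} ∧
        ∃ v ∈ lowWeight F (Fin n) (d - 1), v ∈ C}.ncard := by
    refine Set.ncard_le_ncard fun C hC => ?_
    obtain ⟨hC1, v, hv, hvC⟩ := hC
    exact ⟨hC1, v, lowWeight_mono (by omega) hv, hvC⟩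
  gcongr

end Proportion

/-! ### Passage to the limit over prime powers -/

section Limits

theorem tendsto_qToInfty (n k : ℕ) :
    Tendsto (fun q : PrimePower => (q.1 : ℝ)) (qToInfty n k) atTop :=
  tendsto_natCast_atTop_atTop.comp (tendsto_comap.mono_left inf_le_left)

theorem eventually_qToInfty (n k : ℕ) :
    ∀ᶠ q : PrimePower in qToInfty n k, 2 < q.1 ∧ k ≤ wittIndex (Fq q) n := by
  have h : Tendsto (fun q : PrimePower => q.1) (qToInfty n k) atTop :=
    tendsto_comap.mono_left inf_le_left
  have h2 : ∀ᶠ q : PrimePower in qToInfty n k, k ≤ wittIndex (Fq q) n :=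
    mem_inf_of_right (mem_principal_self _)
  exact (h.eventually_gt_atTop 2).and h2

theorem eventually_proportion_bounds_of_two_mul_lt {n k d : ℕ} (hd : 4 ≤ d) (hdn : d < n)
    (hk : k = n - d + 1) (hkn : 2 * k < n) :
    ∀ᶠ q : PrimePower in qToInfty n k,
      (q.1 : ℝ) * proportion (Fq q) n k d ≤
        upperBound (n.choose k) k q.1 + q.1 * singularBound k q.1 ∧
      lowerBound (n.choose k) (2 * (d - 2 : ℕ) + 3) ((n.choose k) ^ 2 * 8 : ℕ) k q.1 /
        (1 + singularBound k q.1) ≤ (q.1 : ℝ) * proportion (Fq q) n k d := by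
  filter_upwards [eventually_qToInfty n k] with q hq
  have := Fintype.ofFinite (Fq q)
  have hcard : Fintype.card (Fq q) = q.1 := by
    rw [← Nat.card_eq_fintype_card, card_Fq]
  have h := proportion_bounds_of_two_mul_lt (F := Fq q) (by rw [hcard]; exact hq.1) hd hdn hk hkn
  rwa [hcard] at h

theorem eventually_proportion_bounds_of_two_mul_eq {n k d : ℕ} (hd : 4 ≤ d) (hdn : d < n)
    (hk : k = n - d + 1) (hkn : 2 * k = n) :
    ∀ᶠ q : PrimePower in qToInfty n k,
      (q.1 : ℝ) * proportion (Fq q) n k d ≤ upperBound (n.choose (d - 1)) k q.1 ∧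
      lowerBound (n.choose (d - 2)) (2 * (d - 3 : ℕ) + 3) ((n.choose (d - 2)) ^ 2 * 4 : ℕ) k
        q.1 ≤ (q.1 : ℝ) ^ 2 * proportion (Fq q) n k d := by
  filter_upwards [eventually_qToInfty n k] with q hq
  have := Fintype.ofFinite (Fq q)
  have hcard : Fintype.card (Fq q) = q.1 := by
    rw [← Nat.card_eq_fintype_card, card_Fq]
  have h := proportion_bounds_of_two_mul_eq (F := Fq q) (by rw [hcard]; exact hq.1) hd hdn hk hkn
    hq.2
  rwa [hcard] at h

/-- In `EReal` no boundedness of `g` is needed, and along the trivial filter the lower limit is `⊤`.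
Hence it need not be known that infinitely many `q` are admissible. -/
theorem coe_le_liminf_of_tendsto {α : Type*} {l : Filter α} {f g : α → ℝ} {c : ℝ}
    (hf : Tendsto f l (𝓝 c)) (hfg : ∀ᶠ x in l, f x ≤ g x) :
    (c : EReal) ≤ liminf (fun x => (g x : EReal)) l := by
  rcases l.eq_or_neBot with rfl | hl
  · simp
  · have h : Tendsto (fun x => (f x : EReal)) l (𝓝 (c : EReal)) :=
      (continuous_coe_real_ereal.tendsto c).comp hf
    rw [← h.liminf_eq]
    exact liminf_le_liminf (hfg.mono fun x hx => EReal.coe_le_coe_iff.2 hx)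

theorem limsup_le_coe_of_tendsto {α : Type*} {l : Filter α} {f g : α → ℝ} {c : ℝ}
    (hf : Tendsto f l (𝓝 c)) (hfg : ∀ᶠ x in l, g x ≤ f x) :
    limsup (fun x => (g x : EReal)) l ≤ (c : EReal) := by
  rcases l.eq_or_neBot with rfl | hl
  · simp
  · have h : Tendsto (fun x => (f x : EReal)) l (𝓝 (c : EReal)) :=
      (continuous_coe_real_ereal.tendsto c).comp hf
    rw [← h.limsup_eq]
    exact limsup_le_limsup (hfg.mono fun x hx => EReal.coe_le_coe_iff.2 hx)

end Limits

end

end SelfOrthCode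

theorem mainTheorem4 (n k d : ℕ) (hd : 4 ≤ d) (hdn : d < n) (hk : k = n - d + 1) :
    (2 * k < n →
      Tendsto
        (fun q : SelfOrthCode.PrimePower =>
          SelfOrthCode.proportion (SelfOrthCode.Fq q) n k d /
            ((n.choose k : ℝ) * ((q.1 : ℝ))⁻¹))
        (SelfOrthCode.qToInfty n k) (𝓝 1)) ∧
    (2 * k = n →
      ((n.choose (d - 2) : ℝ) : EReal) ≤
        liminf
          (fun q : SelfOrthCode.PrimePower =>
            (((q.1 : ℝ) ^ 2 * SelfOrthCode.proportion (SelfOrthCode.Fq q) n k d : ℝ) : EReal))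
          (SelfOrthCode.qToInfty n k) ∧
      limsup
          (fun q : SelfOrthCode.PrimePower =>
            (((q.1 : ℝ) * SelfOrthCode.proportion (SelfOrthCode.Fq q) n k d : ℝ) : EReal))
          (SelfOrthCode.qToInfty n k) ≤
        ((n.choose (d - 1) : ℝ) : EReal)) := by
  have hq := SelfOrthCode.tendsto_qToInfty n k
  refine ⟨fun hkn => ?_, fun hkn => ⟨?_, ?_⟩⟩
  · have hb := SelfOrthCode.eventually_proportion_bounds_of_two_mul_lt hd hdn hk hkn
    have hup := ((SelfOrthCode.tendsto_upperBound (n.choose k) k).add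
      (SelfOrthCode.tendsto_mul_singularBound k)).comp hq
    have hlow := ((SelfOrthCode.tendsto_lowerBound (n.choose k) (2 * (d - 2 : ℕ) + 3)
      ((n.choose k) ^ 2 * 8 : ℕ) k).div ((SelfOrthCode.tendsto_singularBound k).const_add 1)
      (by norm_num)).comp hq
    rw [add_zero] at hup
    rw [add_zero, div_one] at hlow
    have h := tendsto_of_tendsto_of_tendsto_of_le_of_le' hlow hup
      (hb.mono fun q h => h.2) (hb.mono fun q h => h.1)
    have hc : (n.choose k : ℝ) ≠ 0 := by
      exact_mod_cast (Nat.choose_pos (by omega)).ne'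
    have h2 := h.div_const (n.choose k : ℝ)
    rw [div_self hc] at h2
    refine h2.congr fun q => ?_
    rw [← div_div, div_inv_eq_mul, mul_comm, mul_div_right_comm, mul_comm]
  · have hb := SelfOrthCode.eventually_proportion_bounds_of_two_mul_eq hd hdn hk hkn
    exact SelfOrthCode.coe_le_liminf_of_tendsto
      ((SelfOrthCode.tendsto_lowerBound _ _ _ k).comp hq) (hb.mono fun q h => h.2)
  · have hb := SelfOrthCode.eventually_proportion_bounds_of_two_mul_eq hd hdn hk hkn
    exact SelfOrthCode.limsup_le_coe_of_tendsto
      ((SelfOrthCode.tendsto_upperBound _ k).comp hq) (hb.mono fun q h => h.1)
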